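/- **Lemma (companion congruences).** Let $p>5$ be a prime, and let $\alpha=\{r_1,1-r_1,r_2,1-r_2\}$ be one of the fourteen multi-sets for which either $r_1,r_2\in\{\frac12,\frac13,\frac14,\frac16\}$ or $(r_1,r_2)\in\{(\frac15,\frac25),(\frac18,\frac38),(\frac1{10},\frac3{10}),(\frac1{12},\frac5{12})\}$. For $x\in\mathbb Z_p$ let $[x]_0\in\{0,1,\dots,p-1\}$ be its first $p$-adic digit, i.e. $x\equiv[x]_0\pmod p$, and for $r\in\mathbb Q\cap\mathbb Z_p$ put $r'=(r+[-r]_0)/p$. Relabel the elements of $\alpha$ (with multiplicity) as $r_1,r_2,r_3,r_4$ in such a way that $r_1'\le r_2'\le r_3'\le r_4'$, and put $a_j=[-r_j]_0$. Let $\Gamma_p$ be Morita's $p$-adic Gamma function, that is, the continuous function on $\mathbb Z_p$ with $\Gamma_p(n)=(-1)^n\prod_{0<i<n,\;p\nmid i}i$ for integers $n\ge0$. Let $G_1=\Gamma_p'/\Gamma_p$ and $G_2=\Gamma_p''/\Gamma_p$ (here primes denote derivatives), and for integers $k\ge 0$ set $$J_1(k)=\sum_{j=1}^4\bigl(G_1(r_j+k)-G_1(1+k)\bigr),$$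 $$J_2(k)=10\,G_1(1+k)^2-4\,G_1(1+k)\sum_{j=1}^4G_1(r_j+k)+\sum_{1\le j<\ell\le4}G_1(r_j+k)\,G_1(r_\ell+k)+\frac12\sum_{j=1}^4\bigl(G_2(r_j+k)-G_2(1+k)\bigr).$$ Write $(r)_k=r(r+1)\cdots(r+k-1)$, $(r)_0=1$, and $P_k=\prod_{j=1}^4(r_j)_k/k!^4$. Define the elements $$\widetilde C_1=p\sum_{k=0}^{a_2}P_k\,(J_1(k)k+1)+\frac1{r_1'}\sum_{k=a_1+1}^{a_3}P_k\,k+\frac1{r_2'}\sum_{k=a_2+1}^{a_3}P_k\,k,$$ $$\widetilde C_2=p^2\sum_{k=0}^{a_1}P_k\,\bigl(J_2(k)k^2+J_1(k)k\bigr)+p\sum_{k=a_1+1}^{a_2}P_k\,(J_1(k)k+1)\frac k{r_1'}+\frac1{r_1'r_2'}\sum_{k=a_2+1}^{a_3}P_k\,k^2$$ of $\mathbb Q_p$. Then, where $x\equiv y\pmod{p^3}$ means $x-y\in p^3\mathbb Z_p$, $$\widetilde C_1\equiv(-1)^{a_1+a_2}\,p\pmod{p^3}\qquad\text{and}\qquad\widetilde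 C_2\equiv-(-1)^{a_1+a_2}\,p^2\pmod{p^3}.$$ -/

import Mathlib

open Filter Topology

noncomputable section

namespace Companion

/-- The multi-sets `{r₁, 1 - r₁, r₂, 1 - r₂}` of the fourteen hypergeometric families. -/
def IsCYMultiset (α : Multiset ℚ) : Prop :=
  ∃ r₁ r₂ : ℚ,
    ((r₁ ∈ ({1 / 2, 1 / 3, 1 / 4, 1 / 6} : Set ℚ) ∧ r₂ ∈ ({1 / 2, 1 / 3, 1 / 4, 1 / 6} : Set ℚ)) ∨
      (r₁, r₂) ∈ ({(1 / 5, 2 / 5), (1 / 8, 3 / 8), (1 / 10, 3 / 10), (1 / 12, 5 / 12)} :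
        Set (ℚ × ℚ))) ∧
    α = {r₁, 1 - r₁, r₂, 1 - r₂}

variable (p : ℕ) [Fact p.Prime]

/-- The first `p`-adic digit `[x]₀ ∈ {0, …, p - 1}` of a `p`-adic integer `x`
(by convention `0` when `x ∈ ℚ_p` is not a `p`-adic integer). -/
def firstDigit (x : ℚ_[p]) : ℕ :=
  open Classical in if h : ‖x‖ ≤ 1 then (PadicInt.toZMod (⟨x, h⟩ : ℤ_[p])).val else 0

/-- `[-r]₀` for a rational number `r`. -/
def negDigit (r : ℚ) : ℕ := firstDigit p (-(r : ℚ_[p]))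

/-- Dwork's dash operation `r' = (r + [-r]₀) / p`. -/
def dash (r : ℚ) : ℚ := (r + negDigit p r) / p

/-- `r 0, r 1, r 2, r 3` (that is, `r₁, r₂, r₃, r₄`) is a labelling of the elements of `α`, with
multiplicity, such that `r₁' ≤ r₂' ≤ r₃' ≤ r₄'`. -/
def IsOrderedLabelling (α : Multiset ℚ) (r : Fin 4 → ℚ) : Prop :=
  Finset.univ.val.map r = α ∧ Monotone fun j => dash p (r j)

/-- Values of the `p`-adic Gamma function at natural numbers:
`(-1)ⁿ` times the product of all `0 < i < n` prime to `p`. -/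
def padicGammaNat (n : ℕ) : ℤ :=
  (-1) ^ n * ∏ i ∈ (Finset.range n).filter (fun i => ¬ p ∣ i), (i : ℤ)

/-- Morita's `p`-adic Gamma function on `ℤ_p`: `Γ_p(x)` is the limit of `Γ_p(n)` over natural
numbers `n` tending `p`-adically to `x`. -/
def padicGammaInt (x : ℤ_[p]) : ℤ_[p] :=
  limUnder (comap (fun n : ℕ => (n : ℤ_[p])) (𝓝 x)) (fun n : ℕ => (padicGammaNat p n : ℤ_[p]))

/-- `Γ_p` as a function on `ℚ_p`, extended by zero outside of the open set `ℤ_p`. -/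
def padicGamma (x : ℚ_[p]) : ℚ_[p] :=
  open Classical in if h : ‖x‖ ≤ 1 then (padicGammaInt p ⟨x, h⟩ : ℚ_[p]) else 0

/-- `G₁ = Γ_p' / Γ_p`. -/
def G₁ (t : ℚ_[p]) : ℚ_[p] := deriv (padicGamma p) t / padicGamma p t

/-- `G₂ = Γ_p'' / Γ_p`. -/
def G₂ (t : ℚ_[p]) : ℚ_[p] := deriv (deriv (padicGamma p)) t / padicGamma p t

def J₁ (r : Fin 4 → ℚ) (a : ℕ) : ℚ_[p] :=
  ∑ j, (G₁ p ((r j : ℚ_[p]) + a) - G₁ p (1 + a))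

def J₂ (r : Fin 4 → ℚ) (a : ℕ) : ℚ_[p] :=
  10 * G₁ p (1 + a) ^ 2 - 4 * G₁ p (1 + a) * ∑ j, G₁ p ((r j : ℚ_[p]) + a)
    + ∑ j, ∑ l ∈ Finset.Ioi j, G₁ p ((r j : ℚ_[p]) + a) * G₁ p ((r l : ℚ_[p]) + a)
    + 1 / 2 * ∑ j, (G₂ p ((r j : ℚ_[p]) + a) - G₂ p (1 + a))

/-- The quotient `(r₁)_k (r₂)_k (r₃)_k (r₄)_k / k!⁴`. -/
def pochQuot (r : Fin 4 → ℚ) (k : ℕ) : ℚ :=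
  (∏ j, (ascPochhammer ℚ k).eval (r j)) / (k.factorial : ℚ) ^ 4

/-- The sum `C̃₁`; here `a₁, a₂, a₃` are `negDigit p (r 0)`, `negDigit p (r 1)`,
`negDigit p (r 2)`. -/
def Ctilde₁ (r : Fin 4 → ℚ) : ℚ_[p] :=
  (p : ℚ_[p]) * ∑ k ∈ Finset.Icc 0 (negDigit p (r 1)),
      (pochQuot r k : ℚ_[p]) * (J₁ p r k * k + 1)
    + 1 / (dash p (r 0) : ℚ_[p]) *
      ∑ k ∈ Finset.Icc (negDigit p (r 0) + 1) (negDigit p (r 2)), (pochQuot r k : ℚ_[p]) * k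
    + 1 / (dash p (r 1) : ℚ_[p]) *
      ∑ k ∈ Finset.Icc (negDigit p (r 1) + 1) (negDigit p (r 2)), (pochQuot r k : ℚ_[p]) * k

/-- The sum `C̃₂`, with the same conventions as for `C̃₁`. -/
def Ctilde₂ (r : Fin 4 → ℚ) : ℚ_[p] :=
  (p : ℚ_[p]) ^ 2 * ∑ k ∈ Finset.Icc 0 (negDigit p (r 0)),
      (pochQuot r k : ℚ_[p]) * (J₂ p r k * (k : ℚ_[p]) ^ 2 + J₁ p r k * k)
    + (p : ℚ_[p]) * ∑ k ∈ Finset.Icc (negDigit p (r 0) + 1) (negDigit p (r 1)),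
      (pochQuot r k : ℚ_[p]) * (J₁ p r k * k + 1) * ((k : ℚ_[p]) / (dash p (r 0) : ℚ_[p]))
    + 1 / ((dash p (r 0) : ℚ_[p]) * (dash p (r 1) : ℚ_[p])) *
      ∑ k ∈ Finset.Icc (negDigit p (r 1) + 1) (negDigit p (r 2)),
        (pochQuot r k : ℚ_[p]) * (k : ℚ_[p]) ^ 2

/-- Congruence `x ≡ y mod p^m`: the difference lies in `p^m ℤ_p`. -/
def PadicCongr (m : ℕ) (x y : ℚ_[p]) : Prop :=
  ∃ z : ℤ_[p], x - y = (p : ℚ_[p]) ^ m * (z : ℚ_[p])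

end Companion

end

/-! Both sums are residue sums of rational functions in disguise. Indices start at 0, as in the
code, and r_j = -a_j + p y_j with y_j = r_j'. The symmetry r ↦ 1 - r of α pairs r_0 with r_3 and r_1
with r_2, so a_0 + a_3 = a_1 + a_2 = p - 1. For k ≤ a_2, P_k is a p-integral A_k times one factor p
y_j for each j with a_j < k.

Let R(X) = ∏_{j=0,1} ∏_{i<a_j} (X + i + 1 - p y_j) / ∏_{j=0,1} ∏_{i≤a_j} (X - i + p y_j). For k ≤
a_1 remove from R the denominator factors with i = k. Modulo p² the value of the rest at X = k is
(-1)^(a_0+a_1) A_k and its logarithmic derivative is J₁(k); modulo p the derivative of that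
logarithmic derivative is 2J₂(k) - J₁(k)². As X R(X) behaves like 1/X at infinity, its residues add
up to 1 (`sq_dvd_sum_sub_sign`). Modulo p there is a second function, with a third family of poles
0, …, a_2 and a numerator of degree a_0. Multiplied by X^n with n ≤ 2 it decays at least like
X^(-2), so its residues add up to 0 (`dvd_sum_jet`).

Now C̃₁/p is exactly the first residue sum plus p(y_0 + y_1) times the second one for n = 1, and
C̃₂/p² is congruent modulo p to the second sum for n = 2 minus C̃₁/p. This gives both congruences.

The p-adic input is `exists_logDeriv`. By the functional equation of Γ_p, the logarithmic
derivatives G₁ and G₂ - G₁² are determined by their restrictions to pℤ_p, where G₁ is constant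
modulo p² and G₂ - G₁² vanishes modulo p. These facts come from the Newton series of n ↦ Γ_p(pn),
whose coefficients are small (`exists_newton_coeff`), and from a Wolstenholme-type congruence
(`pow_three_dvd_gammaStep_one_sub`). -/

namespace Companion

open Polynomial

/-! ### Convergent series of polynomials over ℤ_p. -/

section PolySeries

variable {p : ℕ} [Fact p.Prime]

lemma tendsto_zero_of_pow_dvd {β : ℕ → ℤ_[p]} {e : ℕ → ℕ} (he : Tendsto e atTop atTop)
    (h : ∀ k, (p : ℤ_[p]) ^ e k ∣ β k) : Tendsto β atTop (𝓝 0) := by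
  have hp1 : (1 : ℝ) < p := by exact_mod_cast (Fact.out : p.Prime).one_lt
  refine squeeze_zero_norm (a := fun k => ((p : ℝ)⁻¹) ^ e k) (fun k => ?_)
    ((tendsto_pow_atTop_nhds_zero_of_lt_one (by positivity) (inv_lt_one_of_one_lt₀ hp1)).comp he)
  obtain ⟨c, hc⟩ := h k
  rw [hc, norm_mul, norm_pow, PadicInt.norm_p]
  exact mul_le_of_le_one_right (by positivity) (PadicInt.norm_le_one c)

lemma summable_mul_of_tendsto_zero {β : ℕ → ℤ_[p]} (hβ : Tendsto β atTop (𝓝 0)) (c : ℕ → ℤ_[p]) :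
    Summable fun k => β k * c k := by
  refine NonarchimedeanAddGroup.summable_of_tendsto_cofinite_zero ?_
  rw [Nat.cofinite_eq_atTop]
  refine squeeze_zero_norm (a := fun k => ‖β k‖) (fun k => ?_) (by simpa using hβ.norm)
  rw [norm_mul]
  exact mul_le_of_le_one_right (norm_nonneg _) (PadicInt.norm_le_one _)

lemma pow_dvd_tsum {f : ℕ → ℤ_[p]} {n : ℕ} (h : ∀ k, (p : ℤ_[p]) ^ n ∣ f k) :
    (p : ℤ_[p]) ^ n ∣ ∑' k, f k := by
  rw [← Ideal.mem_span_singleton, ← PadicInt.norm_le_pow_iff_mem_span_pow]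
  refine IsUltrametricDist.norm_tsum_le_of_forall_le_of_nonneg (by positivity) fun k => ?_
  rw [PadicInt.norm_le_pow_iff_mem_span_pow, Ideal.mem_span_singleton]
  exact h k

/-- The function `y ↦ ∑ₖ βₖ Wₖ(y)`. -/
noncomputable def polySeries (β : ℕ → ℤ_[p]) (W : ℕ → ℤ_[p][X]) (y : ℤ_[p]) : ℤ_[p] :=
  ∑' k, β k * (W k).eval y

/-- Each Taylor remainder of a polynomial over ℤ_p is integral, so the remainders sum with the same
weights. This gives differentiability with an integral quadratic error. -/
lemma polySeries_add {β : ℕ → ℤ_[p]} (hβ : Tendsto β atTop (𝓝 0)) (W : ℕ → ℤ_[p][X])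
    (y h : ℤ_[p]) : ∃ κ, polySeries β W (y + h) =
      polySeries β W y + polySeries β (fun k => derivative (W k)) y * h + κ * h ^ 2 := by
  choose κ hκ using fun k => (⟨_, ((W k).binomExpansion y h).2⟩ : ∃ κ, (W k).eval (y + h) =
    (W k).eval y + (derivative (W k)).eval y * h + κ * h ^ 2)
  refine ⟨∑' k, β k * κ k, ?_⟩
  have s := summable_mul_of_tendsto_zero hβ
  unfold polySeries
  rw [← (s _).tsum_mul_right, ← (s _).tsum_mul_right, ← (s _).tsum_add ((s _).mul_right _),
    ← Summable.tsum_add (((s _).add ((s _).mul_right _))) ((s _).mul_right _)]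
  refine tsum_congr fun k => ?_
  rw [hκ]; ring

lemma polySeries_sub_sum_dvd {β : ℕ → ℤ_[p]} (hβ : Tendsto β atTop (𝓝 0)) (W : ℕ → ℤ_[p][X])
    {m n : ℕ} (h : ∀ k, m ≤ k → (p : ℤ_[p]) ^ n ∣ β k) (y : ℤ_[p]) :
    (p : ℤ_[p]) ^ n ∣ polySeries β W y - ∑ k ∈ Finset.range m, β k * (W k).eval y := by
  have s := summable_mul_of_tendsto_zero hβ (fun k => (W k).eval y)
  rw [polySeries, ← s.sum_add_tsum_nat_add m, add_sub_cancel_left]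
  exact pow_dvd_tsum fun k => Dvd.dvd.mul_right (h _ (by omega)) _

end PolySeries

open scoped fwdDiff

/-! ### Finite differences of n ↦ Γ_p(pn). -/

section Differences

lemma fwdDiff_iter_comp_natCast (f : ℤ → ℤ) (i : ℕ) (n : ℕ) :
    (Δ_[1])^[i] (fun m : ℕ => f m) n = (Δ_[1])^[i] f n := by
  simp [fwdDiff_iter_eq_sum_shift]

/-- Since P(X + c) - P(X) = c R(X), one difference of m ↦ P(cm) is c times a function of the same
shape; iterate. -/
lemma pow_dvd_fwdDiff_iter_eval (c : ℤ) (i : ℕ) : ∀ (P : ℤ[X]) (n : ℤ),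
    c ^ i ∣ (Δ_[1])^[i] (fun m : ℤ => P.eval (c * m)) n := by
  induction i with
  | zero => intro P n; simp
  | succ i ih =>
    intro P n
    obtain ⟨R, hR⟩ : (C c : ℤ[X]) ∣ P.comp (X + C c) - P := by
      have := Polynomial.sub_dvd_eval_sub (X + C c) X (P.map C)
      simpa [eval_map, ← Polynomial.comp_eq_sum_left, Polynomial.comp] using this
    have h : Δ_[1] (fun m : ℤ => P.eval (c * m)) = c • (fun m : ℤ => R.eval (c * m)) := by
      ext m
      have := congrArg (Polynomial.eval (c * m)) hR
      simp only [eval_sub, eval_comp, eval_add, eval_X, eval_C, eval_mul] at this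
      simp only [fwdDiff, Pi.smul_apply, smul_eq_mul, ← this]
      ring_nf
    rw [Function.iterate_succ_apply, h, fwdDiff_iter_const_smul, pow_succ', Pi.smul_apply,
      smul_eq_mul]
    exact mul_dvd_mul_left _ (ih R n)

/-- The exponent `k - ⌊k / p⌋`. -/
def diffExponent (p k : ℕ) : ℕ := k - k / p

lemma diffExponent_add_le (p a b : ℕ) :
    diffExponent p (a + b) ≤ diffExponent p a + diffExponent p b := by
  have h1 := Nat.div_add_div_le_add_div (x := a) (y := b) (z := p)
  have h2 := Nat.div_le_self a p
  have h3 := Nat.div_le_self b p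
  unfold diffExponent
  omega

/-- The Leibniz rule Δ(EF) = ΔE · F(· + 1) + E · ΔF. The offsets a and b count differences already
taken of each factor, and subadditivity of `diffExponent` closes the base case. -/
lemma pow_diffExponent_dvd_fwdDiff_iter_mul (p k : ℕ) : ∀ (E F : ℕ → ℤ) (a b : ℕ),
    (∀ i ≤ k, ∀ n, (p : ℤ) ^ diffExponent p (a + i) ∣ (Δ_[1])^[i] E n) →
    (∀ i ≤ k, ∀ n, (p : ℤ) ^ diffExponent p (b + i) ∣ (Δ_[1])^[i] F n) →
    ∀ n, (p : ℤ) ^ diffExponent p (a + b + k) ∣ (Δ_[1])^[k] (fun n => E n * F n) n := by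
  induction k with
  | zero =>
    intro E F a b hE hF n
    refine (pow_dvd_pow _ (diffExponent_add_le p a b)).trans ?_
    rw [pow_add]
    exact mul_dvd_mul (hE 0 le_rfl n) (hF 0 le_rfl n)
  | succ k ih =>
    intro E F a b hE hF n
    have h : Δ_[1] (fun n => E n * F n) =
        (fun n => Δ_[1] E n * F (n + 1)) + fun n => E n * Δ_[1] F n := by
      ext m; simp only [fwdDiff, Pi.add_apply]; ring
    rw [Function.iterate_succ_apply, h, fwdDiff_iter_add, Pi.add_apply]
    refine dvd_add ?_ ?_
    · rw [show a + b + (k + 1) = (a + 1) + b + k by ring]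
      refine ih (Δ_[1] E) (fun n => F (n + 1)) (a + 1) b (fun i hi n => ?_) (fun i hi n => ?_) n
      · rw [← Function.iterate_succ_apply, show a + 1 + i = a + (i + 1) by ring]
        exact hE _ (by omega) n
      · rw [fwdDiff_iter_comp_add]
        exact hF _ (by omega) _
    · rw [show a + b + (k + 1) = a + (b + 1) + k by ring]
      refine ih E (Δ_[1] F) a (b + 1) (fun i hi n => hE i (by omega) n) (fun i hi n => ?_) n
      rw [← Function.iterate_succ_apply, show b + 1 + i = b + (i + 1) by ring]
      exact hF _ (by omega) n

lemma prod_X_add_eq_zmod (p : ℕ) [Fact p.Prime] :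
    ∏ c ∈ Finset.Icc 1 (p - 1), (X + C (c : ZMod p)) = X ^ (p - 1) - 1 := by
  have hp := (Fact.out : p.Prime)
  have hcard : (Finset.univ.erase (0 : ZMod p)).card = p - 1 := by
    rw [Finset.card_erase_of_mem (Finset.mem_univ _), Finset.card_univ, ZMod.card]
  have hm : (∏ c ∈ Finset.Icc 1 (p - 1), (X + C (c : ZMod p))).Monic :=
    monic_prod_of_monic _ _ fun c _ => monic_X_add_C _
  have hm' : (X ^ (p - 1) - 1 : (ZMod p)[X]).Monic :=
    monic_X_pow_sub_C 1 (by have := hp.two_le; omega)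
  have hd : (∏ c ∈ Finset.Icc 1 (p - 1), (X + C (c : ZMod p))).degree = ((p - 1 : ℕ) : WithBot ℕ) := by
    rw [degree_prod]; simp only [degree_X_add_C]; simp
  have hd' : (X ^ (p - 1) - 1 : (ZMod p)[X]).degree = ((p - 1 : ℕ) : WithBot ℕ) :=
    degree_X_pow_sub_C (by have := hp.two_le; omega) 1
  refine Polynomial.eq_of_degree_sub_lt_of_eval_finset_eq (Finset.univ.erase (0 : ZMod p)) ?_ ?_
  · rw [hcard, ← hd]
    exact degree_sub_lt_left (hd.trans hd'.symm) hm.ne_zero (by rw [hm.leadingCoeff, hm'.leadingCoeff])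
  · intro x hx
    have hx0 : x ≠ 0 := Finset.ne_of_mem_erase hx
    simp only [eval_sub, eval_pow, eval_X, eval_one, ZMod.pow_card_sub_one_eq_one hx0, sub_self]
    rw [eval_prod]
    refine Finset.prod_eq_zero (i := (-x).val) ?_ ?_
    · have h1 := ZMod.val_lt (-x)
      have h2 : (-x).val ≠ 0 := by simpa using hx0
      simp only [Finset.mem_Icc]; omega
    · simp

/-- The quotient `Γ_p(p(n+1)) / Γ_p(pn)`. -/
def gammaStep (p : ℕ) (n : ℤ) : ℤ := -∏ c ∈ Finset.Icc 1 (p - 1), ((p : ℤ) * n + c)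

variable (p : ℕ) [Fact p.Prime]

/-- Lifts the factorisation of X^(p-1) - 1 over 𝔽_p to ℤ, with an error p u(X). -/
lemma exists_gammaStep_eq : ∃ u : ℤ[X], ∀ n : ℤ,
    gammaStep p n = 1 - ((p : ℤ) * n) ^ (p - 1) - p * u.eval (p * n) := by
  obtain ⟨u, hu⟩ : (C (p : ℤ)) ∣
      ∏ c ∈ Finset.Icc 1 (p - 1), (X + C (c : ℤ)) - (X ^ (p - 1) - 1) := by
    rw [C_dvd_iff_dvd_coeff]
    intro i
    rw [← ZMod.intCast_zmod_eq_zero_iff_dvd]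
    have h := prod_X_add_eq_zmod p
    have h2 := congrArg (fun P => coeff P i) (sub_eq_zero.2 h)
    rw [coeff_zero] at h2
    rw [← h2, ← eq_intCast (Int.castRingHom (ZMod p)), ← coeff_map]
    simp [Polynomial.map_prod]
  refine ⟨u, fun n => ?_⟩
  have := congrArg (eval ((p : ℤ) * n)) hu
  simp only [eval_sub, eval_prod, eval_add, eval_X, eval_C, eval_pow, eval_one, eval_mul] at this
  unfold gammaStep
  linarith

/-- The part p u(pn) gains a full power of p with each difference. The part (pn)^(p-1) is only known
to carry p^(p-1), but its differences of order above p - 1 vanish. The one loss, at i = p - 1, is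
why the exponent is k - ⌊k/p⌋ and not k. -/
lemma pow_dvd_fwdDiff_iter_gammaStep_sub_one (i n : ℕ) :
    (p : ℤ) ^ diffExponent p (1 + i) ∣ (Δ_[1])^[i] (fun n : ℕ => gammaStep p n - 1) n := by
  have hp := (Fact.out : p.Prime)
  obtain ⟨u, hu⟩ := exists_gammaStep_eq p
  have h : (fun n : ℤ => gammaStep p n - 1) = ((-(p : ℤ) ^ (p - 1)) • fun n : ℤ => n ^ (p - 1))
      + ((-(p : ℤ)) • fun n : ℤ => u.eval ((p : ℤ) * n)) := by
    ext m
    rw [hu]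
    simp only [Pi.add_apply, Pi.smul_apply, smul_eq_mul, mul_pow]
    ring
  rw [fwdDiff_iter_comp_natCast (fun n => gammaStep p n - 1), h, fwdDiff_iter_add,
    fwdDiff_iter_const_smul, fwdDiff_iter_const_smul]
  simp only [Pi.add_apply, Pi.smul_apply, smul_eq_mul]
  have hle : diffExponent p (1 + i) ≤ 1 + i := Nat.sub_le _ _
  refine dvd_add ?_ ?_
  · by_cases hi : p - 1 < i
    · rw [fwdDiff_iter_pow_eq_zero_of_lt hi]; simp
    · refine Dvd.dvd.mul_right ((pow_dvd_pow (n := p - 1) _ ?_).trans (dvd_neg.2 dvd_rfl)) _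
      · have h2 := hp.two_le
        rcases Nat.lt_or_ge (1 + i) p with h | h
        · omega
        · have : 1 ≤ (1 + i) / p := (Nat.one_le_div_iff (by omega)).2 h
          unfold diffExponent; omega
  · refine (pow_dvd_pow _ hle).trans ?_
    rw [pow_add, pow_one]
    exact mul_dvd_mul (dvd_neg.2 dvd_rfl) (pow_dvd_fwdDiff_iter_eval _ _ _ _)

omit [Fact p.Prime] in
lemma padicGammaNat_mul_add (n c : ℕ) (hc : c ≤ p) :
    padicGammaNat p (p * n + c) =
      padicGammaNat p (p * n) * ((-1) ^ c * ∏ i ∈ Finset.Ico 1 c, ((p : ℤ) * n + i)) := by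
  induction c with
  | zero => simp
  | succ c ih =>
    have ih := ih (by omega)
    rcases Nat.eq_zero_or_pos c with rfl | h0
    · have : p ∣ p * n := dvd_mul_right _ _
      simp [padicGammaNat, pow_succ, Finset.range_add_one, Finset.filter_insert]
    · have hnd : ¬ p ∣ p * n + c := by
        rw [Nat.dvd_add_right (dvd_mul_right _ _)]
        exact Nat.not_dvd_of_pos_of_lt h0 (by omega)
      rw [Finset.prod_Ico_succ_top (by omega)]
      have : padicGammaNat p (p * n + (c + 1)) = padicGammaNat p (p * n + c) * (-(p * n + c)) := by
        rw [← add_assoc]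
        simp only [padicGammaNat, Finset.range_add_one, Finset.filter_insert, hnd,
          not_false_eq_true, if_true]
        rw [Finset.prod_insert (by simp)]
        push_cast; ring
      rw [this, ih]; ring

/-- The values `Γ_p(pn)`. -/
def gammaMul (n : ℕ) : ℤ := padicGammaNat p (p * n)

omit [Fact p.Prime] in
lemma gammaMul_zero : gammaMul p 0 = 1 := by simp [gammaMul, padicGammaNat]

variable {p} in
lemma gammaMul_succ (hp2 : p ≠ 2) (n : ℕ) :
    gammaMul p (n + 1) = gammaStep p n * gammaMul p n := by
  have hp := (Fact.out : p.Prime)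
  have : Finset.Ico 1 p = Finset.Icc 1 (p - 1) := by
    ext; simp only [Finset.mem_Ico, Finset.mem_Icc]; have := hp.two_le; omega
  have hodd : (-1 : ℤ) ^ p = -1 := (hp.odd_of_ne_two hp2).neg_one_pow
  rw [gammaMul, mul_add, mul_one, padicGammaNat_mul_add p n p le_rfl, gammaStep, gammaMul, this,
    hodd]
  ring

variable {p} in
-- The recursion reads Δ`gammaMul` = (`gammaStep` - 1) · `gammaMul`; the first factor supplies one
-- extra difference, hence strong induction with offsets 1 and 0.
lemma pow_dvd_fwdDiff_iter_gammaMul (hp2 : p ≠ 2) (k : ℕ) : ∀ n,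
    (p : ℤ) ^ diffExponent p k ∣ (Δ_[1])^[k] (gammaMul p) n := by
  induction k using Nat.strong_induction_on with
  | _ k ih =>
    intro n
    cases k with
    | zero => simp [diffExponent]
    | succ k =>
      have h : Δ_[1] (gammaMul p) = fun n : ℕ => (gammaStep p n - 1) * gammaMul p n := by
        ext m
        rw [fwdDiff, gammaMul_succ hp2]; ring
      rw [Function.iterate_succ_apply, h, show k + 1 = 1 + 0 + k by ring]
      refine pow_diffExponent_dvd_fwdDiff_iter_mul p k (fun n : ℕ => gammaStep p n - 1)
        (gammaMul p) 1 0 (fun i _ n => pow_dvd_fwdDiff_iter_gammaStep_sub_one p i n)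
        (fun i hi n => ?_) n
      rw [zero_add]
      exact ih i (by omega) n

end Differences

/-! ### The Newton series of Γ_p on pℤ_p. -/

section GammaSeries

variable {p : ℕ} [Fact p.Prime]

/-- Reflection c ↦ p - c; the p - 1 signs cancel because p is odd. -/
lemma gammaStep_neg_one (hp2 : p ≠ 2) : gammaStep p (-1) = gammaStep p 0 := by
  have hp := (Fact.out : p.Prime)
  have heven : (-1 : ℤ) ^ (p - 1) = 1 :=
    (Nat.Odd.sub_odd (hp.odd_of_ne_two hp2) odd_one).neg_one_pow
  have h : ∏ c ∈ Finset.Icc 1 (p - 1), ((p : ℤ) * 0 + c) =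
      ∏ c ∈ Finset.Icc 1 (p - 1), ((-1 : ℤ) * ((p : ℤ) * (-1) + c)) := by
    refine Finset.prod_bij' (fun c _ => p - c) (fun c _ => p - c) ?_ ?_ ?_ ?_ ?_
    all_goals intro c hc; simp only [Finset.mem_Icc] at hc
    · simp only [Finset.mem_Icc]; omega
    · simp only [Finset.mem_Icc]; omega
    · omega
    · omega
    · rw [Nat.cast_sub (by omega)]; ring
  rw [gammaStep, gammaStep, h, Finset.prod_mul_distrib, Finset.prod_const, Nat.card_Icc,
    Nat.add_sub_cancel, heven, one_mul]

/-- A form of Wolstenholme's theorem. The equality of the steps at -1 and 0 forces the linear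
coefficient of u to be divisible by p, and u(-p) - u(p) is -2p times that coefficient modulo p². -/
lemma pow_three_dvd_gammaStep_one_sub (hp5 : 5 ≤ p) :
    (p : ℤ) ^ 3 ∣ gammaStep p 1 - gammaStep p 0 := by
  have hp := (Fact.out : p.Prime)
  obtain ⟨u, hu⟩ := exists_gammaStep_eq p
  have hneg := gammaStep_neg_one (p := p) (by omega)
  have heven : Even (p - 1) := Nat.Odd.sub_odd (hp.odd_of_ne_two (by omega)) odd_one
  have h1 : gammaStep p 1 - gammaStep p 0 = (p : ℤ) * (u.eval (-p : ℤ) - u.eval (p : ℤ)) := by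
    rw [← hneg, hu, hu, mul_neg, heven.neg_pow]; ring_nf
  have h0 : (p : ℤ) * (p ^ (p - 2) + u.eval (-p : ℤ) - u.eval 0) = 0 := by
    have := hu 0
    rw [← hneg, hu, mul_neg, heven.neg_pow, mul_zero, zero_pow (by omega), mul_one] at this
    have h3 : (p : ℤ) ^ (p - 1) = p * p ^ (p - 2) := by rw [← pow_succ']; congr 1; omega
    rw [h3] at this
    linarith
  have hp0 : (p : ℤ) ≠ 0 := by exact_mod_cast hp.ne_zero
  have h0 := (mul_eq_zero.1 h0).resolve_left hp0
  obtain ⟨k, hk⟩ := u.binomExpansion 0 (p : ℤ)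
  obtain ⟨l, hl⟩ := u.binomExpansion 0 (-p : ℤ)
  rw [zero_add] at hk hl
  have h3 : (p : ℤ) ^ (p - 2) = p * (p * p ^ (p - 4)) := by
    rw [← pow_succ', ← pow_succ']; congr 1; omega
  rw [h3, hl] at h0
  set d := (derivative u).eval 0
  have h4 : (p : ℤ) * (p * p ^ (p - 4) - d + l * p) = 0 := by linear_combination h0
  have h4 := (mul_eq_zero.1 h4).resolve_left hp0
  refine ⟨l - k - 2 * (p ^ (p - 4) + l), ?_⟩
  rw [h1, hk, hl]
  linear_combination 2 * (p : ℤ) ^ 2 * h4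

/-- Here β_k = Δ^k/k!, of valuation at least k - ⌊k/p⌋ - v_p(k!). For p ≥ 7 one has ⌊k/p⌋ ≤ k/7 and
v_p(k!) ≤ k/6, which leaves at least 3 once k ≥ 3, and tends to infinity. -/
lemma exists_newton_coeff (hp7 : 7 ≤ p) : ∃ β : ℕ → ℤ_[p],
    (∀ k : ℕ, (k.factorial : ℤ_[p]) * β k = (((Δ_[1])^[k] (gammaMul p) 0 : ℤ) : ℤ_[p])) ∧
    (∀ k, 3 ≤ k → (p : ℤ_[p]) ^ 3 ∣ β k) ∧ Tendsto β atTop (𝓝 0) := by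
  have hp := (Fact.out : p.Prime)
  set v : ℕ → ℕ := fun k => padicValNat p k.factorial
  have hv : ∀ k, 6 * v k ≤ k := fun k => by
    have h1 := sub_one_mul_padicValNat_factorial (p := p) k
    have h2 : 6 * v k ≤ (p - 1) * v k := Nat.mul_le_mul_right _ (by omega)
    have h3 : (p - 1) * v k ≤ k := by simp only [v]; omega
    omega
  have hd : ∀ k, 7 * (k / p) ≤ k := fun k =>
    (Nat.mul_le_mul_right _ hp7).trans (Nat.mul_div_le k p)
  have key : ∀ k : ℕ, ∃ b : ℤ_[p],
      (k.factorial : ℤ_[p]) * b = (((Δ_[1])^[k] (gammaMul p) 0 : ℤ) : ℤ_[p]) ∧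
      (p : ℤ_[p]) ^ (diffExponent p k - v k) ∣ b := fun k => by
    obtain ⟨t, ht⟩ := pow_dvd_fwdDiff_iter_gammaMul (p := p) (by omega) k 0
    obtain ⟨m, hm⟩ : p ^ v k ∣ k.factorial := pow_padicValNat_dvd
    have hpm : ¬ p ∣ m := fun ⟨c, hc⟩ => by
      refine pow_succ_padicValNat_not_dvd (p := p) k.factorial_ne_zero ⟨c, ?_⟩
      rw [pow_succ, mul_assoc, ← hc]; exact hm
    have hu : IsUnit (m : ℤ_[p]) := by
      rw [PadicInt.isUnit_iff, PadicInt.norm_natCast_eq_one_iff]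
      exact (Nat.Prime.coprime_iff_not_dvd hp).2 hpm
    obtain ⟨w, hw⟩ := hu.exists_right_inv
    refine ⟨p ^ (diffExponent p k - v k) * (t * w), ?_, dvd_mul_right _ _⟩
    have hle : v k ≤ diffExponent p k := by
      have := hv k; have := hd k; unfold diffExponent; omega
    rw [ht, hm]
    push_cast
    rw [← Nat.sub_add_cancel hle, Nat.add_sub_cancel, pow_add]
    linear_combination (p : ℤ_[p]) ^ v k * p ^ (diffExponent p k - v k) * t * hw
  choose β h1 h2 using key
  refine ⟨β, h1, fun k hk => (pow_dvd_pow _ ?_).trans (h2 k), tendsto_zero_of_pow_dvd ?_ h2⟩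
  · have := hv k; have := hd k; unfold diffExponent; omega
  · refine tendsto_atTop.2 fun b => ?_
    filter_upwards [eventually_ge_atTop (2 * b)] with k hk
    have := hv k; have := hd k; unfold diffExponent; omega

lemma continuous_of_forall_add {g d : ℤ_[p] → ℤ_[p]}
    (h : ∀ y h, ∃ κ, g (y + h) = g y + d y * h + κ * h ^ 2) : Continuous g := by
  refine (LipschitzWith.of_dist_le_mul (K := 1) fun x y => ?_).continuous
  obtain ⟨κ, hκ⟩ := h y (x - y)
  rw [add_sub_cancel] at hκ
  rw [dist_eq_norm, dist_eq_norm, hκ,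
    show g y + d y * (x - y) + κ * (x - y) ^ 2 - g y = (d y + κ * (x - y)) * (x - y) by ring,
    norm_mul]
  exact mul_le_mul_of_nonneg_right (PadicInt.norm_le_one _) (norm_nonneg _)

/-- The restriction of `Γ_p` to `pℤ_p`, in the coordinate `y = x / p`, and its derivatives. -/
theorem exists_gammaSeries (hp7 : 7 ≤ p) : ∃ g g₁ g₂ : ℤ_[p] → ℤ_[p],
    (∀ n : ℕ, g n = (gammaMul p n : ℤ_[p])) ∧
    (∀ y h, ∃ κ, g (y + h) = g y + p * g₁ y * h + κ * h ^ 2) ∧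
    (∀ y h, ∃ κ, p * g₁ (y + h) = p * g₁ y + p ^ 2 * g₂ y * h + κ * h ^ 2) ∧
    (∀ y, IsUnit (g y)) ∧
    (∀ y, g (y + 1) = -(∏ i ∈ Finset.Ico 1 p, ((p : ℤ_[p]) * y + i)) * g y) ∧
    g 0 = 1 ∧
    (∀ y, (p : ℤ_[p]) ^ 2 ∣ g₁ y - g₁ 0 * g y) ∧
    (∀ y, (p : ℤ_[p]) ∣ g₂ y * g y - g₁ y ^ 2) := by
  have hp := (Fact.out : p.Prime)
  have hp0 : (p : ℤ_[p]) ≠ 0 := by exact_mod_cast hp.ne_zero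
  obtain ⟨β, hβ, hβ3, hlim⟩ := exists_newton_coeff hp7
  set W : ℕ → ℤ_[p][X] := fun k => descPochhammer ℤ_[p] k with hW
  have W0 : W 0 = 1 := descPochhammer_zero _
  have W1 : W 1 = X := descPochhammer_one _
  have W2 : W 2 = X * (X - 1) := by simp [hW, descPochhammer_succ_right]
  set g := polySeries β W
  have hg : ∀ n : ℕ, g n = (gammaMul p n : ℤ_[p]) := fun n => by
    have h := shift_eq_sum_fwdDiff_iter 1 (gammaMul p) n 0
    simp only [smul_eq_mul, mul_one, zero_add, nsmul_eq_mul] at h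
    rw [h, Int.cast_sum]
    refine (tsum_eq_sum (s := Finset.range (n + 1)) fun k hk => ?_).trans
      (Finset.sum_congr rfl fun k _ => ?_)
    · have : n < k := by simpa using hk
      simp [hW, descPochhammer_eval_eq_descFactorial, Nat.descFactorial_eq_zero_iff_lt.2 this]
    · simp only [hW, descPochhammer_eval_eq_descFactorial]
      rw [Nat.descFactorial_eq_factorial_mul_choose]
      push_cast
      rw [← hβ]
      ring
  have hΔ1 : β 1 = (gammaStep p 0 : ℤ_[p]) - 1 := by
    have := hβ 1
    simpa [fwdDiff, gammaMul_succ (p := p) (by omega) 0, gammaMul_zero,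
      show gammaMul p 1 = gammaStep p 0 * gammaMul p 0 from gammaMul_succ (by omega) 0] using this
  have hΔ2 : 2 * β 2 = (gammaStep p 1 : ℤ_[p]) * gammaStep p 0 - 2 * gammaStep p 0 + 1 := by
    have := hβ 2
    simp only [Nat.factorial, Function.iterate_succ, Function.iterate_zero, Function.comp, id,
      fwdDiff, zero_add, show 1 + 1 = 2 from rfl,
      show gammaMul p 1 = gammaStep p 0 * gammaMul p 0 from gammaMul_succ (by omega) 0,
      show gammaMul p 2 = gammaStep p 1 * gammaMul p 1 from gammaMul_succ (by omega) 1,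
      gammaMul_zero] at this
    push_cast at this
    linear_combination this
  have hβ0 : β 0 = 1 := by simpa [gammaMul_zero] using hβ 0
  have hb1 : (p : ℤ_[p]) ∣ β 1 := by
    rw [hΔ1]
    have h := pow_dvd_fwdDiff_iter_gammaStep_sub_one p 0 0
    have h1 : diffExponent p 1 = 1 := by
      simp [diffExponent, Nat.div_eq_of_lt (show 1 < p by omega)]
    simp only [add_zero, h1, pow_one, Function.iterate_zero, id] at h
    have := (Int.castRingHom ℤ_[p]).map_dvd h
    simpa using this
  -- With s_n = `gammaStep p n`, 2β₂ - β₁² = (s₁ - s₀) s₀. So modulo p³ the series looks like an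
  -- exponential: its logarithm is linear, which yields the last two claims.
  have hrel : (p : ℤ_[p]) ^ 3 ∣ 2 * β 2 - β 1 ^ 2 := by
    obtain ⟨c, hc⟩ := pow_three_dvd_gammaStep_one_sub (p := p) (by omega)
    have hc : (gammaStep p 1 : ℤ_[p]) - gammaStep p 0 = p ^ 3 * c := by exact_mod_cast hc
    exact ⟨gammaStep p 0 * c, by rw [hΔ2, hΔ1]; linear_combination (gammaStep p 0 : ℤ_[p]) * hc⟩
  have h2u : IsUnit (2 : ℤ_[p]) := by
    have : IsUnit ((2 : ℕ) : ℤ_[p]) := by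
      rw [PadicInt.isUnit_iff, PadicInt.norm_natCast_eq_one_iff]
      exact (Nat.coprime_primes hp Nat.prime_two).2 (by omega)
    exact_mod_cast this
  obtain ⟨b1, hb1⟩ := hb1
  obtain ⟨c, hc⟩ := hrel
  have hb2 : (p : ℤ_[p]) ^ 2 ∣ β 2 := by
    refine (h2u.dvd_mul_left).1 ⟨b1 ^ 2 + p * c, ?_⟩
    rw [hb1] at hc
    linear_combination hc
  obtain ⟨b2, hb2⟩ := hb2
  have e0 := polySeries_sub_sum_dvd hlim W hβ3
  have e1 := polySeries_sub_sum_dvd hlim (fun k => derivative (W k)) hβ3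
  have e2 := polySeries_sub_sum_dvd hlim (fun k => derivative (derivative (W k))) hβ3
  simp only [Finset.sum_range_succ, Finset.sum_range_zero, W0, W1, W2, hβ0, hb1, hb2, derivative_one,
    derivative_X, derivative_mul, derivative_sub, eval_add, eval_mul, eval_sub, eval_one, eval_X,
    eval_zero, derivative_add, derivative_zero] at e0 e1 e2
  choose k0 hk0 using e0
  choose k1 hk1 using e1
  choose k2 hk2 using e2
  have hg1 : ∀ y, polySeries β (fun k => derivative (W k)) y =
      p * (b1 + p * b2 * (2 * y - 1) + p ^ 2 * k1 y) := fun y => by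
    linear_combination hk1 y
  have hg2 : ∀ y, polySeries β (fun k => derivative (derivative (W k))) y =
      p ^ 2 * (2 * b2 + p * k2 y) := fun y => by
    linear_combination hk2 y
  have hg0 : ∀ y, g y = 1 + p * b1 * y + p ^ 2 * b2 * (y * (y - 1)) + p ^ 3 * k0 y := fun y => by
    linear_combination hk0 y
  have hc2 : 2 * b2 - b1 ^ 2 = p * c := by
    refine mul_left_cancel₀ (pow_ne_zero 2 hp0) ?_
    rw [hb1, hb2] at hc
    linear_combination hc
  have hexp : ∀ y h, ∃ κ, g (y + h) = g y +
      p * (b1 + p * b2 * (2 * y - 1) + p ^ 2 * k1 y) * h + κ * h ^ 2 := fun y h => by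
    obtain ⟨κ, hκ⟩ := polySeries_add hlim W y h
    exact ⟨κ, hκ.trans (by rw [hg1])⟩
  have hg00 : g 0 = 1 := by
    have := hg 0
    rwa [gammaMul_zero, Nat.cast_zero, Int.cast_one] at this
  have hcont : Continuous g := continuous_of_forall_add hexp
  refine ⟨g, fun y => b1 + p * b2 * (2 * y - 1) + p ^ 2 * k1 y, fun y => 2 * b2 + p * k2 y,
    hg, hexp, fun y h => ?_, fun y => ?_, fun y => ?_, hg00, fun y => ?_, fun y => ?_⟩
  · obtain ⟨κ, hκ⟩ := polySeries_add hlim (fun k => derivative (W k)) y h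
    exact ⟨κ, by beta_reduce; rw [← hg1, ← hg1, ← hg2, hκ]⟩
  · by_contra h
    rw [PadicInt.not_isUnit_iff, PadicInt.norm_lt_one_iff_dvd] at h
    obtain ⟨d, hd⟩ := h
    refine PadicInt.prime_p.not_isUnit (isUnit_of_dvd_one (a := (p : ℤ_[p]))
      ⟨d - (b1 * y + p * b2 * (y * (y - 1)) + p ^ 2 * k0 y), ?_⟩)
    linear_combination hd - hg0 y
  -- Both sides are continuous and agree on ℕ by the recursion for `gammaMul`; ℕ is dense in ℤ_p.
  · have hR : Continuous fun y : ℤ_[p] => -(∏ i ∈ Finset.Ico 1 p, ((p : ℤ_[p]) * y + i)) * g y := by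
      fun_prop
    have hL : Continuous fun y : ℤ_[p] => g (y + 1) := by fun_prop
    refine congrFun (PadicInt.denseRange_natCast.equalizer hL hR (funext fun n => ?_)) y
    have : Finset.Ico 1 p = Finset.Icc 1 (p - 1) := by
      ext; simp only [Finset.mem_Ico, Finset.mem_Icc]; omega
    have h1 : (n : ℤ_[p]) + 1 = ((n + 1 : ℕ) : ℤ_[p]) := by push_cast; rfl
    simp only [Function.comp_apply]
    rw [h1, hg, hg, gammaMul_succ (by omega), gammaStep, this]
    push_cast
    rfl
  · refine ⟨k1 y - k1 0 + y * c - b1 * b2 * y ^ 2 * 1 + b1 * b2 * y - b1 * (p * k0 y)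
      + (b2 - p * k1 0) * (b1 * y + p * b2 * (y * (y - 1)) + p ^ 2 * k0 y), ?_⟩
    rw [hg0]
    linear_combination (p : ℤ_[p]) * y * hc2
  · refine ⟨c + k2 y + (2 * b2 + p * k2 y) * (b1 * y + p * b2 * (y * (y - 1)) + p ^ 2 * k0 y)
      - 2 * b1 * (b2 * (2 * y - 1) + p * k1 y) - p * (b2 * (2 * y - 1) + p * k1 y) ^ 2, ?_⟩
    rw [hg0]
    linear_combination hc2

end GammaSeries

/-! ### Γ_p on all of ℤ_p and its functional equation. -/

section FunctionalEquation

variable {p : ℕ} [Fact p.Prime]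

lemma padicGammaInt_eq_of_tendsto {x L : ℤ_[p]}
    (h : Tendsto (fun n : ℕ => (padicGammaNat p n : ℤ_[p]))
      (comap (fun n : ℕ => (n : ℤ_[p])) (𝓝 x)) (𝓝 L)) : padicGammaInt p x = L := by
  have : (comap (fun n : ℕ => (n : ℤ_[p])) (𝓝 x)).NeBot :=
    comap_neBot_iff_frequently.2 (mem_closure_iff_frequently.1 (PadicInt.denseRange_natCast x))
  exact h.limUnder_eq

lemma exists_eq_mul_add (x : ℤ_[p]) : ∃ y : ℤ_[p], ∃ c : ℕ, c < p ∧ x = p * y + c := by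
  have h := x.sub_zmodRepr_mem
  rw [PadicInt.maximalIdeal_eq_span_p, Ideal.mem_span_singleton] at h
  obtain ⟨y, hy⟩ := h
  exact ⟨y, _, x.zmodRepr_lt_p, by rw [← hy]; ring⟩

lemma isUnit_mul_add_natCast_iff {y : ℤ_[p]} {c : ℕ} (hc : c < p) :
    IsUnit ((p : ℤ_[p]) * y + c) ↔ c ≠ 0 := by
  rw [← not_iff_not, PadicInt.not_isUnit_iff, PadicInt.norm_lt_one_iff_dvd,
    dvd_add_right (dvd_mul_right _ _), ← PadicInt.norm_lt_one_iff_dvd,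
    PadicInt.norm_natCast_lt_one_iff, not_not]
  exact ⟨fun h => Nat.eq_zero_of_dvd_of_lt h hc, fun h => h ▸ dvd_zero p⟩

/-- Converts the limit defining Γ_p at py + c into a limit at y, where the Newton series is
continuous. -/
lemma tendsto_natCast_div (y : ℤ_[p]) {c : ℕ} (hc : c < p) :
    (∀ᶠ m in comap (fun n : ℕ => (n : ℤ_[p])) (𝓝 (p * y + c)), m = p * (m / p) + c) ∧
    Tendsto (fun m : ℕ => ((m / p : ℕ) : ℤ_[p]))
      (comap (fun n : ℕ => (n : ℤ_[p])) (𝓝 (p * y + c))) (𝓝 y) := by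
  have hp := (Fact.out : p.Prime)
  have hp0 : (0 : ℝ) < p := by exact_mod_cast hp.pos
  have hball : ∀ ε > 0, ∀ᶠ m : ℕ in comap (fun n : ℕ => (n : ℤ_[p])) (𝓝 (p * y + c)),
      ‖(m : ℤ_[p]) - (p * y + c)‖ < ε := fun ε hε => by
    have h := (tendsto_comap (f := fun n : ℕ => (n : ℤ_[p])) (x := 𝓝 ((p : ℤ_[p]) * y + c)))
    filter_upwards [h (Metric.ball_mem_nhds _ hε)] with m hm
    simpa [dist_eq_norm] using hm
  have hmod : ∀ᶠ m in comap (fun n : ℕ => (n : ℤ_[p])) (𝓝 (p * y + c)), m = p * (m / p) + c := by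
    filter_upwards [hball 1 one_pos] with m hm
    rw [PadicInt.norm_lt_one_iff_dvd] at hm
    have h1 : (p : ℤ_[p]) ∣ ((m - c : ℤ) : ℤ_[p]) := by
      have := dvd_add hm (dvd_mul_right (p : ℤ_[p]) y)
      push_cast
      convert this using 1
      ring
    rw [← PadicInt.norm_lt_one_iff_dvd, PadicInt.norm_intCast_lt_one_iff] at h1
    have h2 : c % p = m % p := (Nat.modEq_iff_dvd.2 h1)
    rw [Nat.mod_eq_of_lt hc] at h2
    rw [h2, Nat.div_add_mod]
  refine ⟨hmod, Metric.tendsto_nhds.2 fun ε hε => ?_⟩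
  filter_upwards [hmod, hball (ε / p) (by positivity)] with m hm hm2
  rw [hm] at hm2
  have : ((p * (m / p) + c : ℕ) : ℤ_[p]) - (p * y + c) = p * (((m / p : ℕ) : ℤ_[p]) - y) := by
    push_cast; ring
  rw [this, norm_mul, PadicInt.norm_p, lt_div_iff₀ hp0] at hm2
  rw [dist_eq_norm]
  calc _ = (p : ℝ)⁻¹ * ‖((m / p : ℕ) : ℤ_[p]) - y‖ * p := by field_simp
    _ < ε := hm2

lemma padicGammaInt_mul_add {g : ℤ_[p] → ℤ_[p]} (hg : ∀ n : ℕ, g n = (gammaMul p n : ℤ_[p]))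
    (hcont : Continuous g) (y : ℤ_[p]) {c : ℕ} (hc : c < p) :
    padicGammaInt p (p * y + c) =
      g y * ((-1) ^ c * ∏ i ∈ Finset.Ico 1 c, ((p : ℤ_[p]) * y + i)) := by
  obtain ⟨hmod, hlim⟩ := tendsto_natCast_div y hc
  have hT : Continuous fun y : ℤ_[p] =>
      g y * ((-1) ^ c * ∏ i ∈ Finset.Ico 1 c, ((p : ℤ_[p]) * y + i)) := by fun_prop
  refine padicGammaInt_eq_of_tendsto (((hT.tendsto y).comp hlim).congr' ?_)
  filter_upwards [hmod] with m hm
  conv_rhs => rw [hm, padicGammaNat_mul_add p _ c hc.le]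
  simp only [Function.comp_apply, hg, gammaMul]
  push_cast
  rfl

lemma padicGammaInt_add_one {g : ℤ_[p] → ℤ_[p]} (hg : ∀ n : ℕ, g n = (gammaMul p n : ℤ_[p]))
    (hcont : Continuous g)
    (hstep : ∀ y, g (y + 1) = -(∏ i ∈ Finset.Ico 1 p, ((p : ℤ_[p]) * y + i)) * g y)
    (hp2 : p ≠ 2) (y : ℤ_[p]) {c : ℕ} (hc : c < p) :
    padicGammaInt p (p * y + c + 1) =
      (if c = 0 then -1 else -(p * y + c)) * padicGammaInt p (p * y + c) := by
  have hp := (Fact.out : p.Prime)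
  rw [padicGammaInt_mul_add hg hcont y hc]
  have key : padicGammaInt p (p * y + c + 1) =
      g y * ((-1) ^ (c + 1) * ∏ i ∈ Finset.Ico 1 (c + 1), ((p : ℤ_[p]) * y + i)) := by
    rcases Nat.lt_or_ge (c + 1) p with h | h
    · rw [← padicGammaInt_mul_add hg hcont y h]
      push_cast
      rw [add_assoc]
    -- The carry: c + 1 = p moves to the block of y + 1, so the step relation of g is needed.
    · have hcp : c + 1 = p := by omega
      have h1 : (p : ℤ_[p]) * y + c + 1 = p * (y + 1) + (0 : ℕ) := by
        have : (c : ℤ_[p]) + 1 = p := by exact_mod_cast hcp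
        push_cast
        linear_combination this
      rw [h1, padicGammaInt_mul_add hg hcont _ hp.pos, hstep, hcp,
        (hp.odd_of_ne_two hp2).neg_one_pow]
      simp
      ring
  rw [key]
  rcases Nat.eq_zero_or_pos c with rfl | h
  · simp
  · rw [if_neg h.ne', Finset.prod_Ico_succ_top (by omega)]
    ring

end FunctionalEquation

/-! ### Second derivatives under a functional equation. -/

section Derivatives

lemma hasDerivAt_of_norm_le_sq {𝕜 : Type*} [NontriviallyNormedField 𝕜] {f : 𝕜 → 𝕜} {x D : 𝕜}
    {C r : ℝ} (hr : 0 < r) (h : ∀ z, ‖z‖ < r → ‖f (x + z) - f x - z * D‖ ≤ C * ‖z‖ ^ 2) :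
    HasDerivAt f D x := by
  rw [hasDerivAt_iff_isLittleO_nhds_zero]
  refine Asymptotics.IsBigO.trans_isLittleO (g := fun z : 𝕜 => z ^ 2)
    (Asymptotics.IsBigO.of_bound C ?_) ?_
  · filter_upwards [Metric.ball_mem_nhds (0 : 𝕜) hr] with z hz
    rw [norm_pow]
    exact h z (by simpa using hz)
  · simpa using Asymptotics.isLittleO_pow_id (𝕜 := 𝕜) (n := 2) one_lt_two

/-- `f` is differentiable near `x`, and twice differentiable at `x`. -/
def TwiceDiffAt {𝕜 : Type*} [NontriviallyNormedField 𝕜] (f : 𝕜 → 𝕜) (x : 𝕜) : Prop :=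
  (∀ᶠ z in 𝓝 x, DifferentiableAt 𝕜 f z) ∧ DifferentiableAt 𝕜 (deriv f) x

/-- The affine factor s + t z covers both branches of the functional equation of Γ_p: the constant
-1 on pℤ_p and -z elsewhere. -/
lemma TwiceDiffAt.add_one {𝕜 : Type*} [NontriviallyNormedField 𝕜] {f : 𝕜 → 𝕜} {x s t : 𝕜}
    (hf : TwiceDiffAt f x) (h : ∀ᶠ z in 𝓝 x, f (z + 1) = (s + t * z) * f z) :
    TwiceDiffAt f (x + 1) ∧ deriv f (x + 1) = t * f x + (s + t * x) * deriv f x ∧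
      deriv (deriv f) (x + 1) = 2 * t * deriv f x + (s + t * x) * deriv (deriv f) x := by
  have hσ : ∀ z, HasDerivAt (fun z => s + t * z) t z := fun z => by
    simpa using ((hasDerivAt_id z).const_mul t).const_add s
  have h1 : ∀ᶠ z in 𝓝 x, HasDerivAt (fun z => f (z + 1)) (t * f z + (s + t * z) * deriv f z) z := by
    filter_upwards [h.eventually_nhds, hf.1] with z hz hd
    exact ((hσ z).mul hd.hasDerivAt).congr_of_eventuallyEq hz
  have h2 : ∀ᶠ z in 𝓝 x, deriv f (z + 1) = t * f z + (s + t * z) * deriv f z := by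
    filter_upwards [h1] with z hz
    rw [← hz.deriv, deriv_comp_add_const]
  have h3 : HasDerivAt (fun z => deriv f (z + 1))
      (2 * t * deriv f x + (s + t * x) * deriv (deriv f) x) x := by
    refine HasDerivAt.congr_of_eventuallyEq ?_ h2
    have := (hf.1.self_of_nhds.hasDerivAt.const_mul t).add ((hσ x).mul hf.2.hasDerivAt)
    rw [show 2 * t * deriv f x + (s + t * x) * deriv (deriv f) x =
      t * deriv f x + (t * deriv f x + (s + t * x) * deriv (deriv f) x) by ring]
    exact this
  refine ⟨⟨?_, differentiableAt_comp_add_const.1 h3.differentiableAt⟩, h2.self_of_nhds, ?_⟩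
  · have hc : Tendsto (fun z : 𝕜 => z - 1) (𝓝 (x + 1)) (𝓝 x) := by
      have : Continuous fun z : 𝕜 => z - 1 := by fun_prop
      simpa using this.tendsto (x + 1)
    filter_upwards [hc.eventually h1] with z hz
    have := differentiableAt_comp_add_const.1 hz.differentiableAt
    rwa [sub_add_cancel] at this
  · rw [← h3.deriv, deriv_comp_add_const]

end Derivatives

/-! ### The logarithmic derivatives G₁ and G₂ - G₁². -/

section LogDerivatives

variable {p : ℕ} [Fact p.Prime]

lemma padicGamma_coe (x : ℤ_[p]) : padicGamma p x = padicGammaInt p x := by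
  rw [padicGamma, dif_pos x.2]; rfl

lemma coe_inv_of_isUnit {x : ℤ_[p]} (hx : IsUnit x) : ((x.inv : ℤ_[p]) : ℚ_[p]) = (x : ℚ_[p])⁻¹ := by
  have h := PadicInt.mul_inv (PadicInt.isUnit_iff.1 hx)
  refine eq_inv_of_mul_eq_one_right ?_
  rw [← PadicInt.coe_mul, h, PadicInt.coe_one]

lemma inv_of_not_isUnit {x : ℤ_[p]} (hx : ¬ IsUnit x) : x.inv = 0 := by
  rw [PadicInt.isUnit_iff, PadicInt.norm_def] at hx
  obtain ⟨k, hk⟩ := x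
  exact dif_neg hx

lemma exists_eq_mul_of_norm_lt_one {z : ℚ_[p]} (hz : ‖z‖ < 1) : ∃ η : ℤ_[p], z = p * η := by
  obtain ⟨η, h⟩ := (PadicInt.norm_lt_one_iff_dvd (⟨z, hz.le⟩ : ℤ_[p])).1 hz
  exact ⟨η, by simpa using congrArg (Subtype.val) h⟩

lemma norm_mul_sq_le (κ η : ℤ_[p]) :
    ‖(κ * η ^ 2 : ℚ_[p])‖ ≤ (p : ℝ) ^ 2 * ‖(p * η : ℚ_[p])‖ ^ 2 := by
  have hp0 : (p : ℝ) ≠ 0 := by exact_mod_cast (Fact.out : p.Prime).ne_zero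
  rw [norm_mul, norm_mul, norm_pow, Padic.norm_p, mul_pow, ← mul_assoc, inv_pow,
    mul_inv_cancel₀ (pow_ne_zero 2 hp0), one_mul]
  exact mul_le_of_le_one_left (by positivity) κ.2

/-- `G₁` and `G₂ - G₁²` are the integral functions `G` and `H`, with the functional equations and
congruences that they inherit from `Γ_p`. -/
theorem exists_logDeriv (hp7 : 7 ≤ p) : ∃ G H : ℤ_[p] → ℤ_[p],
    (∀ x : ℤ_[p], G₁ p x = G x) ∧ (∀ x : ℤ_[p], G₂ p x = H x + (G x : ℚ_[p]) ^ 2) ∧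
    (∀ x, G (x + 1) = G x + x.inv) ∧ (∀ x, H (x + 1) = H x - x.inv ^ 2) ∧
    (∀ y, (p : ℤ_[p]) ^ 2 ∣ G (p * y) - G 0) ∧ ∀ y, (p : ℤ_[p]) ∣ H (p * y) := by
  have hp := (Fact.out : p.Prime)
  have hpQ : (p : ℚ_[p]) ≠ 0 := by exact_mod_cast hp.ne_zero
  obtain ⟨g, g₁, g₂, hg, hexp, hexp₁, hunit, hstep, hg0, hc1, hc2⟩ := exists_gammaSeries hp7
  have hcont := continuous_of_forall_add hexp
  set f := padicGamma p with hf
  have hf0 : ∀ y : ℤ_[p], f (p * y) = g y := fun y => by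
    have h := padicGammaInt_mul_add hg hcont y hp.pos
    rw [hf, ← PadicInt.coe_natCast, ← PadicInt.coe_mul, padicGamma_coe]
    simpa using congrArg ((↑) : ℤ_[p] → ℚ_[p]) h
  -- In the coordinate y = x/p the derivative is p g₁, so the chain rule leaves g₁; likewise g₂
  -- below. Increments of norm less than 1 are exactly those of the form pη.
  have hd1 : ∀ y : ℤ_[p], HasDerivAt f (g₁ y) (p * y) := fun y => by
    refine hasDerivAt_of_norm_le_sq (C := (p : ℝ) ^ 2) one_pos fun z hz => ?_
    obtain ⟨η, rfl⟩ := exists_eq_mul_of_norm_lt_one hz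
    obtain ⟨κ, hκ⟩ := hexp y η
    rw [← mul_add, ← PadicInt.coe_add, hf0, hf0, hκ]
    have h1 : ((g y + p * g₁ y * η + κ * η ^ 2 : ℤ_[p]) : ℚ_[p]) - g y - p * η * g₁ y =
        κ * η ^ 2 := by push_cast; ring
    rw [h1]
    exact norm_mul_sq_le κ η
  have hd1' : ∀ y : ℤ_[p], deriv f (p * y) = g₁ y := fun y => (hd1 y).deriv
  have hd2 : ∀ y : ℤ_[p], HasDerivAt (deriv f) (g₂ y) (p * y) := fun y => by
    refine hasDerivAt_of_norm_le_sq (C := p * (p : ℝ) ^ 2) one_pos fun z hz => ?_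
    obtain ⟨η, rfl⟩ := exists_eq_mul_of_norm_lt_one hz
    obtain ⟨κ, hκ⟩ := hexp₁ y η
    have hκ := congrArg ((↑) : ℤ_[p] → ℚ_[p]) hκ
    push_cast at hκ
    have h1 : (g₁ (y + η) - g₁ y - p * η * g₂ y : ℚ_[p]) = (p : ℚ_[p])⁻¹ * (κ * η ^ 2) := by
      rw [eq_inv_mul_iff_mul_eq₀ hpQ]
      linear_combination hκ
    rw [← mul_add, ← PadicInt.coe_add, hd1', hd1', h1, norm_mul, norm_inv, Padic.norm_p, inv_inv,
      mul_assoc]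
    exact mul_le_mul_of_nonneg_left (norm_mul_sq_le κ η) (by positivity)
  -- On the open unit disc around py + c the residue c is constant, so one branch of the functional
  -- equation holds in a neighbourhood and may be differentiated.
  have hrec : ∀ (y : ℤ_[p]) (c : ℕ), c < p → ∀ᶠ z in 𝓝 ((p * y + c : ℤ_[p]) : ℚ_[p]),
      f (z + 1) = ((if c = 0 then -1 else 0) + (if c = 0 then 0 else -1) * z) * f z := by
    intro y c hc
    filter_upwards [Metric.ball_mem_nhds _ one_pos] with z hz
    rw [Metric.mem_ball, dist_eq_norm] at hz
    obtain ⟨η, hη⟩ := exists_eq_mul_of_norm_lt_one hz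
    have h := padicGammaInt_add_one hg hcont hstep (by omega) (y + η) hc
    have hz1 : z = ((p * (y + η) + c : ℤ_[p]) : ℚ_[p]) := by
      push_cast at hη ⊢
      linear_combination hη
    rw [hz1, ← PadicInt.coe_one, ← PadicInt.coe_add, hf, padicGamma_coe, padicGamma_coe, h]
    split_ifs <;> push_cast <;> ring
  have hT : ∀ (y : ℤ_[p]) (c : ℕ), c < p → TwiceDiffAt f ((p * y + c : ℤ_[p]) : ℚ_[p]) := by
    intro y c
    induction c with
    | zero =>
      intro _
      have h1 : ((p * y + (0 : ℕ) : ℤ_[p]) : ℚ_[p]) = p * y := by push_cast; ring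
      rw [h1]
      refine ⟨?_, (hd2 y).differentiableAt⟩
      filter_upwards [Metric.ball_mem_nhds _ one_pos] with z hz
      rw [Metric.mem_ball, dist_eq_norm] at hz
      obtain ⟨η, hη⟩ := exists_eq_mul_of_norm_lt_one hz
      have hz1 : z = p * ((y + η : ℤ_[p]) : ℚ_[p]) := by
        push_cast
        linear_combination hη
      exact hz1 ▸ (hd1 _).differentiableAt
    | succ c ih =>
      intro hc
      have := (ih (by omega)).add_one (hrec y c (by omega))
      convert this.1 using 1
      push_cast
      ring
  have hne : ∀ x : ℤ_[p], f x ≠ 0 := by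
    intro x
    obtain ⟨y, c, hc, rfl⟩ := exists_eq_mul_add x
    rw [hf, padicGamma_coe, padicGammaInt_mul_add hg hcont y hc]
    refine PadicInt.coe_ne_zero.2 (mul_ne_zero (hunit y).ne_zero
      (mul_ne_zero (pow_ne_zero _ (by simp)) (Finset.prod_ne_zero_iff.2 fun i hi => ?_)))
    rw [Finset.mem_Ico] at hi
    exact ((isUnit_mul_add_natCast_iff (by omega)).2 (by omega)).ne_zero
  have hG : ∀ x : ℤ_[p], G₁ p ((x : ℚ_[p]) + 1) = G₁ p x + x.inv ∧
      G₂ p ((x : ℚ_[p]) + 1) - G₁ p ((x : ℚ_[p]) + 1) ^ 2 =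
        G₂ p x - G₁ p x ^ 2 - (x.inv : ℚ_[p]) ^ 2 := by
    intro x
    have hx := hne x
    obtain ⟨y, c, hc, rfl⟩ := exists_eq_mul_add x
    obtain ⟨-, h1, h2⟩ := (hT y c hc).add_one (hrec y c hc)
    have h0 := (hrec y c hc).self_of_nhds
    simp only [G₁, G₂, ← hf]
    rw [h0, h1, h2]
    rcases eq_or_ne c 0 with rfl | hc0
    -- The convention that `PadicInt.inv` is 0 on non-units matches the branch with constant factor
    -- -1, whose logarithmic derivative is 0.
    · rw [inv_of_not_isUnit (mt (isUnit_mul_add_natCast_iff hc).1 (by simp))]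
      simp only [if_true]
      push_cast at hx ⊢
      constructor <;> field_simp <;> ring
    · have hu := (isUnit_mul_add_natCast_iff (y := y) hc).2 hc0
      rw [coe_inv_of_isUnit hu]
      have hx0 := PadicInt.coe_ne_zero.2 hu.ne_zero
      generalize ((p * y + c : ℤ_[p]) : ℚ_[p]) = x at *
      simp only [hc0, if_false, zero_add, neg_one_mul]
      constructor <;> field_simp <;> ring
  have hbase : ∀ y : ℤ_[p], ∃ v : ℤ_[p], v * g y = 1 ∧ G₁ p (p * y : ℚ_[p]) = g₁ y * v ∧
      G₂ p (p * y : ℚ_[p]) = g₂ y * v := fun y => by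
    obtain ⟨v, hv⟩ := (hunit y).exists_left_inv
    refine ⟨v, hv, ?_⟩
    have hv' : (g y : ℚ_[p])⁻¹ = v := 
      inv_eq_of_mul_eq_one_left (by rw [← PadicInt.coe_mul, hv, PadicInt.coe_one])
    simp only [G₁, G₂, ← hf, hf0, hd1', (hd2 y).deriv, div_eq_mul_inv, hv', and_self]
  have hint : ∀ x : ℤ_[p], ∃ G H : ℤ_[p], G₁ p x = G ∧ G₂ p x - G₁ p x ^ 2 = H := by
    intro x
    obtain ⟨y, c, hc, rfl⟩ := exists_eq_mul_add x
    clear hc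
    induction c with
    | zero =>
      obtain ⟨v, -, h1, h2⟩ := hbase y
      refine ⟨g₁ y * v, g₂ y * v - (g₁ y * v) ^ 2, ?_, ?_⟩
      · push_cast; simpa using h1
      · push_cast; simp [h1, h2]
    | succ c ih =>
      obtain ⟨G, H, h1, h2⟩ := ih
      obtain ⟨h3, h4⟩ := hG (p * y + c)
      have h5 : ((p * y + (c + 1 : ℕ) : ℤ_[p]) : ℚ_[p]) = ((p * y + c : ℤ_[p]) : ℚ_[p]) + 1 := by
        push_cast; ring
      refine ⟨G + (p * y + c : ℤ_[p]).inv, H - (p * y + c : ℤ_[p]).inv ^ 2, ?_, ?_⟩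
      · rw [h5, h3, h1, PadicInt.coe_add]
      · rw [h5, h4, h2, PadicInt.coe_sub, PadicInt.coe_pow]
  choose G H h1 h2 using hint
  have hG0 : ∀ y : ℤ_[p], ∃ v : ℤ_[p], v * g y = 1 ∧ G (p * y) = g₁ y * v ∧
      H (p * y) = g₂ y * v - (g₁ y * v) ^ 2 := fun y => by
    obtain ⟨v, hv, h3, h4⟩ := hbase y
    have h5 := h1 (p * y)
    have h6 := h2 (p * y)
    rw [PadicInt.coe_mul, PadicInt.coe_natCast] at h5 h6
    refine ⟨v, hv, PadicInt.ext ?_, PadicInt.ext ?_⟩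
    · rw [← h5, h3]; push_cast; rfl
    · rw [← h6, h3, h4]; push_cast; rfl
  refine ⟨G, H, h1, fun x => ?_, fun x => PadicInt.ext ?_, fun x => PadicInt.ext ?_, fun y => ?_,
    fun y => ?_⟩
  · rw [← h2, ← h1]; ring
  · rw [← h1, PadicInt.coe_add, PadicInt.coe_add, ← h1, PadicInt.coe_one, (hG x).1]
  · rw [← h2, PadicInt.coe_sub, PadicInt.coe_pow, PadicInt.coe_add, PadicInt.coe_one, ← h2,
      (hG x).2]
  · obtain ⟨v, hv, h3, -⟩ := hG0 y
    obtain ⟨v0, hv0, h4, -⟩ := hG0 0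
    rw [mul_zero] at h4
    rw [hg0, mul_one] at hv0
    obtain ⟨d, hd⟩ := hc1 y
    exact ⟨d * v, by rw [h3, h4, hv0]; linear_combination v * hd + g₁ 0 * hv⟩
  · obtain ⟨v, hv, -, h3⟩ := hG0 y
    obtain ⟨d, hd⟩ := hc2 y
    exact ⟨d * v ^ 2, by rw [h3]; linear_combination v ^ 2 * hd - g₂ y * v * hv⟩

end LogDerivatives

end Companion

namespace Companion

open Polynomial

/-! ### Partial fractions over a commutative ring. -/

section Residues

variable {S : Type*} [CommRing S]

/-- The residue theorem for N/D = ∑ c_k/M_k. Comaximality of the monic M_k replaces distinctness of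
poles, so the ring may have zero divisors, as ℤ/p² does. -/
lemma coeff_eq_sum_of_isCoprime [Nontrivial S] {ι : Type*} {s : Finset ι} {M K c : ι → S[X]}
    {N D : S[X]} (hM : ∀ k ∈ s, (M k).Monic)
    (hcop : (s : Set ι).Pairwise fun k l => IsCoprime (M k) (M l))
    (hD : D = ∏ k ∈ s, M k) (hK : ∀ k ∈ s, M k * K k = D)
    (hN : N.natDegree < D.natDegree) (hc : ∀ k ∈ s, (c k).natDegree < (M k).natDegree)
    (hdvd : ∀ k ∈ s, M k ∣ N - K k * c k) :
    N.coeff (D.natDegree - 1) = ∑ k ∈ s, (c k).coeff ((M k).natDegree - 1) := by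
  classical
  have hDm : D.Monic := hD ▸ monic_prod_of_monic _ _ hM
  have hKm : ∀ k ∈ s, (K k).Monic := fun k hk => (hM k hk).of_mul_monic_left (hK k hk ▸ hDm)
  have hdeg : ∀ k ∈ s, D.natDegree = (M k).natDegree + (K k).natDegree := fun k hk => by
    rw [← hK k hk, (hM k hk).natDegree_mul (hKm k hk)]
  -- The difference is divisible by each M_k, hence by their product D, but has smaller degree than
  -- the monic D.
  have hT : N - ∑ k ∈ s, K k * c k = 0 := by
    by_contra h0
    refine hDm.not_dvd_of_natDegree_lt h0 ?_ ?_
    · refine (natDegree_sub_le _ _).trans_lt (max_lt hN ?_)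
      refine (natDegree_sum_le_of_forall_le s _ (n := D.natDegree - 1) fun k hk => ?_).trans_lt
        (by omega)
      have h1 := natDegree_mul_le (p := K k) (q := c k)
      have h2 := hdeg k hk
      have h3 := hc k hk
      omega
    · rw [hD]
      refine Finset.prod_dvd_of_coprime hcop fun k hk => ?_
      rw [← Finset.add_sum_erase s _ hk, ← sub_sub]
      refine dvd_sub (hdvd k hk) (Finset.dvd_sum fun l hl => Dvd.dvd.mul_right ?_ _)
      rw [Finset.mem_erase] at hl
      refine (hcop hk hl.2 hl.1.symm).dvd_of_dvd_mul_left ?_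
      rw [hK l hl.2, ← hK k hk]
      exact dvd_mul_right _ _
  rw [sub_eq_zero.1 hT, finsetSum_coeff]
  refine Finset.sum_congr rfl fun k hk => ?_
  have h3 := hc k hk
  rw [show D.natDegree - 1 = (K k).natDegree + ((M k).natDegree - 1) by
      have := hdeg k hk; omega,
    coeff_mul_add_eq_of_natDegree_le le_rfl (by omega), (hKm k hk).coeff_natDegree, one_mul]

variable {J : Type*} [Fintype J] (a : J → ℕ) (e : J → S)

/-- The factors of `∏ⱼ ∏_{i ≤ aⱼ} (X - i + eⱼ)` with `i = k`. -/
noncomputable def nodeFactor (k : ℕ) : S[X] := ∏ j, if k ≤ a j then X - C ((k : S) - e j) else 1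

/-- The factors of `∏ⱼ ∏_{i ≤ aⱼ} (X - i + eⱼ)` with `i ≠ k`. -/
noncomputable def coNodeFactor (k : ℕ) : S[X] :=
  ∏ j, ∏ i ∈ (Finset.range (a j + 1)).erase k, (X - C ((i : S) - e j))

lemma nodeFactor_mul_coNodeFactor (k : ℕ) : nodeFactor a e k * coNodeFactor a e k =
    ∏ j, ∏ i ∈ Finset.range (a j + 1), (X - C ((i : S) - e j)) := by
  rw [nodeFactor, coNodeFactor, ← Finset.prod_mul_distrib]
  refine Finset.prod_congr rfl fun j _ => ?_
  split_ifs with h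
  · exact Finset.mul_prod_erase _ (fun i : ℕ => X - C ((i : S) - e j))
      (Finset.mem_range.2 (by omega))
  · rw [Finset.erase_eq_of_notMem (by simpa using h), one_mul]

lemma prod_nodeFactor {n : ℕ} (hn : ∀ j, a j < n) : ∏ k ∈ Finset.range n, nodeFactor a e k =
    ∏ j, ∏ i ∈ Finset.range (a j + 1), (X - C ((i : S) - e j)) := by
  simp only [nodeFactor]
  rw [Finset.prod_comm]
  refine Finset.prod_congr rfl fun j _ => ?_
  rw [← Finset.prod_filter]
  congr 1
  ext i
  have := hn j
  simp only [Finset.mem_filter, Finset.mem_range]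
  omega

lemma monic_nodeFactor (k : ℕ) : (nodeFactor a e k).Monic :=
  monic_prod_of_monic _ _ fun j _ => by
    split_ifs
    · exact monic_X_sub_C _
    · exact monic_one

lemma isCoprime_nodeFactor {k l : ℕ} (h : ∀ i j, IsUnit (((k : S) - e i) - ((l : S) - e j))) :
    IsCoprime (nodeFactor a e k) (nodeFactor a e l) := by
  refine IsCoprime.prod_left fun i _ => IsCoprime.prod_right fun j _ => ?_
  split_ifs
  · exact isCoprime_X_sub_C_of_isUnit_sub (h i j)
  · exact isCoprime_one_right
  · exact isCoprime_one_left
  · exact isCoprime_one_left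

lemma natDegree_prod_nodes [Nontrivial S] :
    (∏ j, ∏ i ∈ Finset.range (a j + 1), (X - C ((i : S) - e j))).natDegree = ∑ j, (a j + 1) := by
  rw [natDegree_prod_of_monic _ _ fun j _ => monic_prod_of_monic _ _ fun i _ => monic_X_sub_C _]
  refine Finset.sum_congr rfl fun j _ => ?_
  rw [natDegree_prod_of_monic _ _ fun i _ => monic_X_sub_C _]
  simp only [natDegree_X_sub_C]
  simp

lemma coeff_eq_sum_nodes [Nontrivial S] {n : ℕ} (hn : ∀ j, a j < n)
    (hu : ∀ k < n, ∀ l < n, k ≠ l → ∀ i j, IsUnit (((k : S) - e i) - ((l : S) - e j)))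
    {N : S[X]} {c : ℕ → S[X]} (hN : N.natDegree < ∑ j, (a j + 1))
    (hc : ∀ k < n, (c k).natDegree < (nodeFactor a e k).natDegree)
    (hdvd : ∀ k < n, nodeFactor a e k ∣ N - coNodeFactor a e k * c k) :
    N.coeff (∑ j, (a j + 1) - 1) =
      ∑ k ∈ Finset.range n, (c k).coeff ((nodeFactor a e k).natDegree - 1) := by
  rw [← natDegree_prod_nodes a e] at hN ⊢
  refine coeff_eq_sum_of_isCoprime (fun k _ => monic_nodeFactor a e k) ?_
    (prod_nodeFactor a e hn).symm (fun k _ => nodeFactor_mul_coNodeFactor a e k) hN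
    (fun k hk => hc k (Finset.mem_range.1 hk)) (fun k hk => hdvd k (Finset.mem_range.1 hk))
  intro k hk l hl hkl
  rw [Finset.mem_coe, Finset.mem_range] at hk hl
  exact isCoprime_nodeFactor a e (hu k hk l hl hkl)

end Residues

/-! ### Second-order expansions given by logarithmic derivatives. -/

section Jets

variable {S : Type*} [CommRing S]

/-- The polynomial `u (1 + l x + h (l² + m) x²)`; for `h = 1/2` this is the Taylor polynomial of a
function with value `u` and logarithmic derivatives `l` and `m` at `x = 0`. -/
noncomputable def jet (h : S) (x : S[X]) (u l m : S) : S[X] :=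
  C u + C (u * l) * x + C (u * (h * (l ^ 2 + m))) * x ^ 2

/-- Logarithmic derivatives add under products; in the x² coefficient the cross term 2h l l' equals
l l' because h = 1/2. -/
lemma X_pow_three_dvd_jet_mul {h : S} (h2 : 2 * h = 1) (x : S[X]) (u l m u' l' m' : S) :
    x ^ 3 ∣ jet h x u l m * jet h x u' l' m' - jet h x (u * u') (l + l') (m + m') := by
  have hC : 2 * C h = (1 : S[X]) := by
    rw [← C_1, ← h2, C_mul]; rfl
  refine ⟨C (u * u') * (C l * C h * (C l' ^ 2 + C m') + C l' * C h * (C l ^ 2 + C m)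
    + C h ^ 2 * (C l ^ 2 + C m) * (C l' ^ 2 + C m') * x), ?_⟩
  simp only [jet, C_mul, C_add, C_pow]
  linear_combination -C u * C u' * C l * C l' * x ^ 2 * hC

/-- `P` agrees with a jet modulo `x³`. -/
def IsJet (h : S) (x P : S[X]) (u l m : S) : Prop := x ^ 3 ∣ P - jet h x u l m

lemma isJet_jet (h : S) (x : S[X]) (u l m : S) : IsJet h x (jet h x u l m) u l m := by
  simp [IsJet]

lemma IsJet.mul {h : S} (h2 : 2 * h = 1) {x P Q : S[X]} {u l m u' l' m' : S}
    (hP : IsJet h x P u l m) (hQ : IsJet h x Q u' l' m') :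
    IsJet h x (P * Q) (u * u') (l + l') (m + m') := by
  have := dvd_add (dvd_add (hQ.mul_left P) (hP.mul_left (jet h x u' l' m')))
    (X_pow_three_dvd_jet_mul h2 x u l m u' l' m')
  unfold IsJet
  convert this using 1
  ring

lemma isJet_one (h : S) (x : S[X]) : IsJet h x 1 1 0 0 := by
  simp [IsJet, jet]

lemma isJet_add_C (h : S) (x : S[X]) {c d : S} (hcd : c * d = 1) :
    IsJet h x (x + C c) c d (-d ^ 2) := by
  simp [IsJet, jet, hcd, add_comm]

lemma IsJet.prod {h : S} (h2 : 2 * h = 1) {x : S[X]} {ι : Type*} {s : Finset ι} {P : ι → S[X]}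
    {u l m : ι → S} (hP : ∀ i ∈ s, IsJet h x (P i) (u i) (l i) (m i)) :
    IsJet h x (∏ i ∈ s, P i) (∏ i ∈ s, u i) (∑ i ∈ s, l i) (∑ i ∈ s, m i) := by
  classical
  induction s using Finset.induction_on with
  | empty => simpa using isJet_one h x
  | insert i s hi ih =>
    rw [Finset.prod_insert hi, Finset.prod_insert hi, Finset.sum_insert hi, Finset.sum_insert hi]
    exact (hP i (Finset.mem_insert_self i s)).mul h2
      (ih fun j hj => hP j (Finset.mem_insert_of_mem hj))

/-- Finds the jet of a quotient Q/P without dividing: the logarithmic derivatives are subtracted. -/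
lemma IsJet.dvd_mul_jet_sub {h : S} (h2 : 2 * h = 1) {x P Q : S[X]} {u l m u' l' m' v k n : S}
    (hP : IsJet h x P u l m) (hQ : IsJet h x Q u' l' m') (hu : u * v = u') (hl : l + k = l')
    (hm : m + n = m') : x ^ 3 ∣ P * jet h x v k n - Q := by
  have h1 := hP.mul h2 (isJet_jet h x v k n)
  rw [hu, hl, hm] at h1
  have := dvd_sub h1 hQ
  rwa [sub_sub_sub_cancel_right] at this

end Jets

/-! ### The two residue identities. -/

section ResidueSums

variable {S : Type*} [CommRing S] [Nontrivial S]

/-- Sum of residues of X N/D with deg D = deg N + 2, hence equal to the leading coefficient 1. The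
e_j multiply to zero, so with x = X - k the two nearby poles at k ≤ a 0 have denominator x² + (e 0 +
e 1)x, and the residue is the x-coefficient after replacing x² by -(e 0 + e 1)x. For k > a 0 it is
the value at x = -e 1. -/
lemma sum_jet_two_eq {h : S} {a : Fin 2 → ℕ} {e : Fin 2 → S} (ha : a 0 ≤ a 1)
    (he : ∀ i j, e i * e j = 0)
    (hu : ∀ k ≤ a 1, ∀ l ≤ a 1, k ≠ l → ∀ i j, IsUnit (((k : S) - e i) - ((l : S) - e j)))
    {N : S[X]} (hN : N.Monic) (hNdeg : N.natDegree = a 0 + a 1) {u l m : ℕ → S}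
    (hjet : ∀ k ≤ a 1, (X - C (k : S)) ^ 3 ∣
      coNodeFactor a e k * jet h (X - C (k : S)) (u k) (l k) (m k) - N) :
    ∑ k ∈ Finset.range (a 1 + 1), (if k ≤ a 0 then
        k * (u k * l k) + u k
          - (e 0 + e 1) * (k * (u k * (h * (l k ^ 2 + m k))) + u k * l k)
      else k * u k - e 1 * (k * (u k * l k) + u k)) = 1 := by
  obtain ⟨β, hβ⟩ : ∃ β : ℕ → S, ∀ k, β k = k * (u k * l k) + u k
      - (e 0 + e 1) * (k * (u k * (h * (l k ^ 2 + m k))) + u k * l k) := ⟨_, fun _ => rfl⟩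
  obtain ⟨δ, hδ⟩ : ∃ δ : ℕ → S, ∀ k, δ k = k * u k - e 1 * (k * (u k * l k) + u k) :=
    ⟨_, fun _ => rfl⟩
  simp only [← hβ, ← hδ]
  set c : ℕ → S[X] := fun k => if k ≤ a 0 then C (k * u k) + C (β k) * (X - C (k : S))
    else C (δ k) with hc
  have hM0 : ∀ k ≤ a 0, nodeFactor a e k = (X - C ((k : S) - e 0)) * (X - C ((k : S) - e 1)) :=
    fun k hk => by simp [nodeFactor, Fin.prod_univ_two, hk, hk.trans ha]
  have hM1 : ∀ k ≤ a 1, ¬ k ≤ a 0 → nodeFactor a e k = X - C ((k : S) - e 1) :=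
    fun k hk hk0 => by simp [nodeFactor, Fin.prod_univ_two, hk, hk0]
  have hd0 : ∀ k ≤ a 0, (nodeFactor a e k).natDegree = 2 := fun k hk => by
    rw [hM0 k hk, (monic_X_sub_C _).natDegree_mul (monic_X_sub_C _), natDegree_X_sub_C,
      natDegree_X_sub_C]
  have hd1 : ∀ k ≤ a 1, ¬ k ≤ a 0 → (nodeFactor a e k).natDegree = 1 := fun k hk hk0 => by
    rw [hM1 k hk hk0, natDegree_X_sub_C]
  have hE : ∀ i j, C (e i) * C (e j) = (0 : S[X]) := fun i j => by rw [← C_mul, he, C_0]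
  have key := coeff_eq_sum_nodes a e (n := a 1 + 1) (N := X * N) (c := c)
    (fun j => by fin_cases j <;> (simp; try omega))
    (fun k hk l hl => hu k (by omega) l (by omega))
    (by rw [monic_X.natDegree_mul hN, natDegree_X, hNdeg, Fin.sum_univ_two]; omega)
    (fun k hk => ?_) (fun k hk => ?_)
  · have h1 : ∑ j, (a j + 1) - 1 = (X * N).natDegree := by
      rw [monic_X.natDegree_mul hN, natDegree_X, hNdeg, Fin.sum_univ_two]; omega
    rw [h1, (monic_X.mul hN).coeff_natDegree] at key
    rw [key]
    refine Finset.sum_congr rfl fun k hk => ?_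
    have hk1 : k ≤ a 1 := by rw [Finset.mem_range] at hk; omega
    by_cases hk0 : k ≤ a 0
    · simp only [hc, hk0, hd0 k hk0, if_true]
      rw [coeff_add, coeff_C_of_ne_zero (by norm_num), coeff_C_mul, coeff_sub, coeff_X_one,
        coeff_C_of_ne_zero (by norm_num)]
      ring
    · simp [hc, hk0, hd1 k hk1 hk0]
  · by_cases hk0 : k ≤ a 0
    · rw [hd0 k hk0]
      simp only [hc, hk0, if_true]
      refine lt_of_le_of_lt ?_ one_lt_two
      compute_degree
    · rw [hd1 k (by omega) hk0]
      simp only [hc, hk0, if_false, natDegree_C]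
      exact one_pos
  · obtain ⟨Q, hQ⟩ := hjet k (by omega)
    by_cases hk0 : k ≤ a 0
    · rw [hM0 k hk0]
      have hM : (X - C ((k : S) - e 0)) * (X - C ((k : S) - e 1)) =
          (X - C (k : S)) ^ 2 + (C (e 0) + C (e 1)) * (X - C (k : S)) := by
        simp only [C_sub]
        linear_combination hE 0 1
      -- The local denominator divides x³, so knowing the expansion modulo x³ suffices.
      have h3 : (X - C (k : S)) ^ 3 = ((X - C (k : S)) ^ 2 + (C (e 0) + C (e 1)) * (X - C (k : S)))
          * (X - C (k : S) - C (e 0) - C (e 1)) := by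
        linear_combination (X - C (k : S)) * (hE 0 0 + 2 * hE 0 1 + hE 1 1)
      rw [hM]
      simp only [hc, hk0, if_true, hβ, jet, C_add, C_mul, C_sub, C_pow] at hQ ⊢
      generalize C (k : S) = K at *
      exact ⟨coNodeFactor a e k * (K * (C (u k) * (C h * (C (l k) ^ 2 + C (m k)))) + C (u k) * C (l k)
        + C (u k) * (C h * (C (l k) ^ 2 + C (m k))) * (X - K - C (e 0) - C (e 1)))
        - X * (X - K - C (e 0) - C (e 1)) * Q, by
          linear_combination -X * hQ + (coNodeFactor a e k * (C (u k) * (C h * (C (l k) ^ 2 + C (m k))))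
            - X * Q) * h3⟩
    · rw [hM1 k (by omega) hk0]
      have h3 : (X - C (k : S)) ^ 3 = (X - C (k : S) + C (e 1)) *
          ((X - C (k : S)) ^ 2 - C (e 1) * (X - C (k : S))) := by
        linear_combination (X - C (k : S)) * hE 1 1
      simp only [hc, hk0, if_false, hδ, jet, C_add, C_mul, C_sub, C_pow] at hQ ⊢
      generalize C (k : S) = K at *
      have h2 : (X - K) ^ 2 = (X - K + C (e 1)) * (X - K - C (e 1)) := by
        linear_combination hE 1 1
      exact ⟨coNodeFactor a e k * (K * (C (u k) * C (l k)) + C (u k)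
        + (K * (C (u k) * (C h * (C (l k) ^ 2 + C (m k)))) + C (u k) * C (l k)) * (X - K - C (e 1))
        + C (u k) * (C h * (C (l k) ^ 2 + C (m k))) * ((X - K) ^ 2 - C (e 1) * (X - K)))
        - X * ((X - K) ^ 2 - C (e 1) * (X - K)) * Q, by
          linear_combination -X * hQ + (coNodeFactor a e k * (C (u k) * (C h * (C (l k) ^ 2
            + C (m k)))) - X * Q) * h3 + coNodeFactor a e k * (K * (C (u k) * (C h * (C (l k) ^ 2
            + C (m k)))) + C (u k) * C (l k)) * h2⟩

/-- Poles of order 3, 2 and 1 on the three successive ranges of k. The degree bound puts P N at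
least two degrees below the denominator, so there is no residue at infinity. -/
lemma sum_jet_three_eq {h : S} {a : Fin 3 → ℕ} (ha : a 0 ≤ a 1) (ha' : a 1 ≤ a 2)
    (hu : ∀ k ≤ a 2, ∀ l ≤ a 2, k ≠ l → IsUnit ((k : S) - (l : S)))
    {N P : S[X]} (hdeg : (P * N).natDegree < a 0 + a 1 + a 2 + 2) {u l m q₀ q₁ q₂ : ℕ → S}
    (hP : ∀ k, P = C (q₀ k) + C (q₁ k) * (X - C (k : S)) + C (q₂ k) * (X - C (k : S)) ^ 2)
    (hjet : ∀ k ≤ a 2, (X - C (k : S)) ^ 3 ∣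
      coNodeFactor a 0 k * jet h (X - C (k : S)) (u k) (l k) (m k) - N) :
    ∑ k ∈ Finset.range (a 2 + 1), (if k ≤ a 0 then
        q₀ k * (u k * (h * (l k ^ 2 + m k))) + q₁ k * (u k * l k) + q₂ k * u k
      else if k ≤ a 1 then q₀ k * (u k * l k) + q₁ k * u k else q₀ k * u k) = 0 := by
  obtain ⟨β, hβ⟩ : ∃ β : ℕ → S, ∀ k, β k = q₀ k * (u k * (h * (l k ^ 2 + m k)))
      + q₁ k * (u k * l k) + q₂ k * u k := ⟨_, fun _ => rfl⟩
  obtain ⟨δ, hδ⟩ : ∃ δ : ℕ → S, ∀ k, δ k = q₀ k * (u k * l k) + q₁ k * u k := ⟨_, fun _ => rfl⟩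
  obtain ⟨γ, hγ⟩ : ∃ γ : ℕ → S, ∀ k, γ k = q₀ k * u k := ⟨_, fun _ => rfl⟩
  simp only [← hβ, ← hδ, ← hγ]
  set c : ℕ → S[X] := fun k =>
    if k ≤ a 0 then C (γ k) + C (δ k) * (X - C (k : S)) + C (β k) * (X - C (k : S)) ^ 2
    else if k ≤ a 1 then C (γ k) + C (δ k) * (X - C (k : S)) else C (γ k) with hc
  have hM0 : ∀ k ≤ a 0, nodeFactor a (0 : Fin 3 → S) k = (X - C (k : S)) ^ 3 := fun k hk => by
    simp only [nodeFactor, Fin.prod_univ_three, hk, hk.trans ha, (hk.trans ha).trans ha', if_true,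
      Pi.zero_apply, sub_zero]
    ring
  have hM1 : ∀ k ≤ a 1, ¬ k ≤ a 0 → nodeFactor a (0 : Fin 3 → S) k = (X - C (k : S)) ^ 2 :=
    fun k hk hk0 => by
      simp only [nodeFactor, Fin.prod_univ_three, hk, hk0, hk.trans ha', if_true, if_false,
        Pi.zero_apply, sub_zero]
      ring
  have hM2 : ∀ k ≤ a 2, ¬ k ≤ a 1 → nodeFactor a (0 : Fin 3 → S) k = X - C (k : S) :=
    fun k hk hk1 => by
      simp only [nodeFactor, Fin.prod_univ_three, hk, hk1, (mt (·.trans ha) hk1 : ¬ k ≤ a 0),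
        if_true, if_false, Pi.zero_apply, sub_zero, one_mul]
  have hd0 : ∀ k ≤ a 0, (nodeFactor a (0 : Fin 3 → S) k).natDegree = 3 := fun k hk => by
    rw [hM0 k hk, (monic_X_sub_C _).natDegree_pow, natDegree_X_sub_C]
  have hd1 : ∀ k ≤ a 1, ¬ k ≤ a 0 → (nodeFactor a (0 : Fin 3 → S) k).natDegree = 2 :=
    fun k hk hk0 => by rw [hM1 k hk hk0, (monic_X_sub_C _).natDegree_pow, natDegree_X_sub_C]
  have hd2 : ∀ k ≤ a 2, ¬ k ≤ a 1 → (nodeFactor a (0 : Fin 3 → S) k).natDegree = 1 :=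
    fun k hk hk0 => by rw [hM2 k hk hk0, natDegree_X_sub_C]
  have key := coeff_eq_sum_nodes a (0 : Fin 3 → S) (n := a 2 + 1) (N := P * N) (c := c)
    (fun j => by fin_cases j <;> (simp; try omega))
    (fun k hk l hl hkl i j => by simpa using hu k (by omega) l (by omega) hkl)
    (by rw [Fin.sum_univ_three]; omega)
    (fun k hk => ?_) (fun k hk => ?_)
  · rw [coeff_eq_zero_of_natDegree_lt (by rw [Fin.sum_univ_three]; omega)] at key
    rw [key]
    refine Finset.sum_congr rfl fun k hk => ?_
    have hk2 : k ≤ a 2 := by rw [Finset.mem_range] at hk; omega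
    by_cases hk0 : k ≤ a 0
    · simp only [hc, hk0, hd0 k hk0, if_true]
      have h1 : (X - C (k : S)) ^ 2 = X ^ 2 - C (2 * (k : S)) * X + C ((k : S) ^ 2) := by
        simp only [C_mul, C_pow, C_ofNat]; ring
      rw [h1]
      simp [coeff_X, -map_mul, -map_pow, -map_natCast]
    by_cases hk1 : k ≤ a 1
    · simp only [hc, hk0, hk1, hd1 k hk1 hk0, if_true, if_false]
      simp [coeff_X, -map_natCast]
    · simp [hc, hk0, hk1, hd2 k hk2 hk1]
  · by_cases hk0 : k ≤ a 0
    · rw [hd0 k hk0]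
      simp only [hc, hk0, if_true]
      refine lt_of_le_of_lt (b := 2) ?_ (by norm_num)
      compute_degree
    by_cases hk1 : k ≤ a 1
    · rw [hd1 k hk1 hk0]
      simp only [hc, hk0, hk1, if_true, if_false]
      refine lt_of_le_of_lt ?_ one_lt_two
      compute_degree
    · rw [hd2 k (by omega) hk1]
      simp only [hc, hk0, hk1, if_false, natDegree_C]
      exact one_pos
  · obtain ⟨Q, hQ⟩ := hjet k (by omega)
    rw [hP k]
    by_cases hk0 : k ≤ a 0
    · rw [hM0 k hk0]
      simp only [hc, hk0, if_true, hβ, hδ, hγ, jet, C_add, C_mul, C_pow] at hQ ⊢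
      generalize X - C (k : S) = x at *
      exact ⟨coNodeFactor a 0 k * (C (q₁ k) * (C (u k) * (C h * (C (l k) ^ 2 + C (m k))))
        + C (q₂ k) * (C (u k) * C (l k)) + C (q₂ k) * (C (u k) * (C h * (C (l k) ^ 2 + C (m k)))) * x)
        - (C (q₀ k) + C (q₁ k) * x + C (q₂ k) * x ^ 2) * Q, by
          linear_combination -(C (q₀ k) + C (q₁ k) * x + C (q₂ k) * x ^ 2) * hQ⟩
    by_cases hk1 : k ≤ a 1
    · rw [hM1 k hk1 hk0]
      simp only [hc, hk0, hk1, if_true, if_false, hδ, hγ, jet, C_add, C_mul, C_pow] at hQ ⊢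
      generalize X - C (k : S) = x at *
      exact ⟨coNodeFactor a 0 k * (C (q₀ k) * (C (u k) * (C h * (C (l k) ^ 2 + C (m k))))
        + C (q₁ k) * (C (u k) * C (l k)) + C (q₂ k) * C (u k)
        + (C (q₁ k) * (C (u k) * (C h * (C (l k) ^ 2 + C (m k))))
        + C (q₂ k) * (C (u k) * C (l k))) * x
        + C (q₂ k) * (C (u k) * (C h * (C (l k) ^ 2 + C (m k)))) * x ^ 2)
        - (C (q₀ k) + C (q₁ k) * x + C (q₂ k) * x ^ 2) * x * Q, by
          linear_combination -(C (q₀ k) + C (q₁ k) * x + C (q₂ k) * x ^ 2) * hQ⟩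
    · rw [hM2 k (by omega) hk1]
      simp only [hc, hk0, hk1, if_false, hγ, jet, C_add, C_mul, C_pow] at hQ ⊢
      generalize X - C (k : S) = x at *
      exact ⟨coNodeFactor a 0 k * (C (q₀ k) * (C (u k) * C (l k)) + C (q₁ k) * C (u k)
        + (C (q₀ k) * (C (u k) * (C h * (C (l k) ^ 2 + C (m k))))
        + C (q₁ k) * (C (u k) * C (l k)) + C (q₂ k) * C (u k)) * x
        + (C (q₁ k) * (C (u k) * (C h * (C (l k) ^ 2 + C (m k))))
        + C (q₂ k) * (C (u k) * C (l k))) * x ^ 2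
        + C (q₂ k) * (C (u k) * (C h * (C (l k) ^ 2 + C (m k)))) * x ^ 3)
        - (C (q₀ k) + C (q₁ k) * x + C (q₂ k) * x ^ 2) * x ^ 2 * Q, by
          linear_combination -(C (q₀ k) + C (q₁ k) * x + C (q₂ k) * x ^ 2) * hQ⟩

end ResidueSums

/-! ### Rearranging shifted factorials and telescoping sums. -/

section ShiftedFactorials

lemma prod_erase_range_add {M : Type*} [CommMonoid M] (f : ℕ → M) (a d : ℕ) :
    ∏ i ∈ (Finset.range (a + 1 + d)).erase a, f i =
      (∏ i ∈ Finset.range a, f i) * ∏ i ∈ Finset.range d, f (a + 1 + i) := by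
  induction d with
  | zero => simp [Finset.range_add_one]
  | succ d ih =>
    rw [← add_assoc, Finset.range_add_one, Finset.erase_insert_of_ne (by omega),
      Finset.prod_insert (by simp), ih, Finset.prod_range_succ, mul_comm, mul_assoc]

/-- Whether a < k or k ≤ a, the arguments on the left together run once through -a, …, -1, 1, …, k.
The erasures drop the argument 0, which is the factor divisible by p in the application. -/
lemma prod_erase_mul_prod_erase {M : Type*} [CommMonoid M] (F : ℤ → M) (a k : ℕ) :
    (∏ i ∈ (Finset.range k).erase a, F (i - a)) *
        ∏ i ∈ (Finset.range (a + 1)).erase k, F (k - i) =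
      (∏ i ∈ Finset.range a, F (-(i + 1))) * ∏ i ∈ Finset.range k, F (i + 1) := by
  rcases Nat.lt_or_ge a k with h | h
  · obtain ⟨d, rfl⟩ := Nat.exists_eq_add_of_le (Nat.succ_le_of_lt h)
    rw [Nat.succ_eq_add_one, prod_erase_range_add (fun i : ℕ => F (i - a)),
      Finset.erase_eq_of_notMem (by simp only [Finset.mem_range]; omega),
      show Finset.range (a + 1 + d) = Finset.range (d + (a + 1)) by rw [add_comm],
      Finset.prod_range_add _ d (a + 1), mul_assoc]
    refine congrArg₂ (· * ·) ?_ (congrArg₂ (· * ·) ?_ ?_)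
    · rw [← Finset.prod_range_reflect]
      refine Finset.prod_congr rfl fun i hi => ?_
      rw [Finset.mem_range] at hi
      congr 1; omega
    · refine Finset.prod_congr rfl fun i _ => ?_
      congr 1; push_cast; ring
    · rw [← Finset.prod_range_reflect]
      refine Finset.prod_congr rfl fun i hi => ?_
      rw [Finset.mem_range] at hi
      congr 1; omega
  · obtain ⟨d, rfl⟩ := Nat.exists_eq_add_of_le h
    have hA : ∏ i ∈ Finset.range k, F (i - (k + d : ℕ)) =
        ∏ i ∈ Finset.range k, F (-((d + i : ℕ) + 1)) := by
      rw [← Finset.prod_range_reflect]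
      refine Finset.prod_congr rfl fun i hi => ?_
      rw [Finset.mem_range] at hi
      congr 1; omega
    have hC : ∏ i ∈ Finset.range k, F (k - i) = ∏ i ∈ Finset.range k, F (i + 1) := by
      rw [← Finset.prod_range_reflect]
      refine Finset.prod_congr rfl fun i hi => ?_
      rw [Finset.mem_range] at hi
      congr 1; omega
    have hD : ∏ i ∈ Finset.range d, F (k - (k + 1 + i : ℕ)) =
        ∏ i ∈ Finset.range d, F (-(i + 1)) := by
      refine Finset.prod_congr rfl fun i _ => ?_
      congr 1; push_cast; ring
    rw [Finset.erase_eq_of_notMem (by simp), show k + d + 1 = k + 1 + d by ring,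
      prod_erase_range_add (fun i : ℕ => F (k - i)),
      show Finset.range (k + d) = Finset.range (d + k) by rw [add_comm k d],
      Finset.prod_range_add, hA, hC, hD,
      mul_comm (∏ i ∈ Finset.range d, F (-(i + 1))) (∏ i ∈ Finset.range k, F (-((d + i : ℕ) + 1))),
      mul_assoc, mul_comm (∏ i ∈ Finset.range k, F (i + 1))]

lemma sum_erase_add_sum_erase {M : Type*} [AddCommMonoid M] (F : ℤ → M) (a k : ℕ) :
    (∑ i ∈ (Finset.range k).erase a, F (i - a)) +
        ∑ i ∈ (Finset.range (a + 1)).erase k, F (k - i) =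
      (∑ i ∈ Finset.range a, F (-(i + 1))) + ∑ i ∈ Finset.range k, F (i + 1) := by
  have := congrArg Multiplicative.toAdd
    (prod_erase_mul_prod_erase (fun n => Multiplicative.ofAdd (F n)) a k)
  simpa only [toAdd_mul, toAdd_prod, toAdd_ofAdd] using this

lemma prod_range_mul_prod_range {M : Type*} [CommMonoid M] (F : ℕ → M) (a k : ℕ) :
    (∏ i ∈ Finset.range k, F (a + i)) * ∏ i ∈ Finset.range a, F i =
      (∏ i ∈ Finset.range k, F i) * ∏ i ∈ Finset.range a, F (k + i) := by
  rw [mul_comm, ← Finset.prod_range_add, ← Finset.prod_range_add, add_comm]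

end ShiftedFactorials

section Telescoping

variable {p : ℕ} [Fact p.Prime] {Φ φ : ℤ_[p] → ℤ_[p]}

lemma add_natCast_eq_add_sum (h : ∀ x, Φ (x + 1) = Φ x + φ x) (x : ℤ_[p]) (n : ℕ) :
    Φ (x + n) = Φ x + ∑ i ∈ Finset.range n, φ (x + i) := by
  induction n with
  | zero => simp
  | succ n ih => rw [Nat.cast_succ, ← add_assoc, h, ih, Finset.sum_range_succ, add_assoc]

/-- Additive counterpart of `prod_single_eq`. As φ(ε) = 0, the step through the node i = a costs
nothing, which matches the erased index. -/
lemma telescope_sub (h : ∀ x, Φ (x + 1) = Φ x + φ x) {ε : ℤ_[p]} (hε : φ ε = 0) (a k : ℕ) :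
    Φ (-a + ε + k) + ∑ i ∈ (Finset.range (a + 1)).erase k, φ ((k : ℤ_[p]) - i + ε) =
      Φ ε + ∑ i ∈ Finset.range k, φ (i + 1 + ε) := by
  have h1 := add_natCast_eq_add_sum h (-a + ε) k
  have h2 := add_natCast_eq_add_sum h (-a + ε) a
  have h3 := sum_erase_add_sum_erase (fun n : ℤ => φ (n + ε)) a k
  have h4 : ∑ i ∈ Finset.range k, φ (-a + ε + i) =
      ∑ i ∈ (Finset.range k).erase a, φ (((i - a : ℤ) : ℤ_[p]) + ε) := by
    rw [Finset.sum_erase _ (by simpa using hε)]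
    refine Finset.sum_congr rfl fun i _ => ?_
    congr 1; push_cast; ring
  have h5 : ∑ i ∈ Finset.range a, φ (-a + ε + i) =
      ∑ i ∈ Finset.range a, φ (((-(i + 1) : ℤ) : ℤ_[p]) + ε) := by
    rw [← Finset.sum_range_reflect]
    refine Finset.sum_congr rfl fun i hi => ?_
    rw [Finset.mem_range] at hi
    congr 1
    rw [Nat.cast_sub (by omega), Nat.cast_sub (by omega)]
    push_cast; ring
  have h6 : (-a + ε + a : ℤ_[p]) = ε := by ring
  rw [h6] at h2
  push_cast at h3 h4 h5
  rw [h1, h2, h4, h5]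
  linear_combination h3

lemma telescope_add (h : ∀ x, Φ (x + 1) = Φ x + φ x) {ε : ℤ_[p]} (hε : φ (-ε) = 0) (a k : ℕ) :
    Φ (1 + a - ε + k) = Φ (-ε) + ∑ i ∈ Finset.range k, φ (i + 1 - ε) +
      ∑ i ∈ Finset.range a, φ (k + i + 1 - ε) := by
  have h1 := add_natCast_eq_add_sum h (-ε) (k + a + 1)
  rw [Finset.sum_range_succ', Finset.sum_range_add] at h1
  have h2 : (-ε + (k + a + 1 : ℕ) : ℤ_[p]) = 1 + a - ε + k := by push_cast; ring
  rw [h2] at h1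
  rw [h1]
  simp only [Nat.cast_zero, add_zero, hε, ← add_assoc]
  congr 1
  · congr 1
    refine Finset.sum_congr rfl fun i _ => ?_
    congr 1; push_cast; ring
  · refine Finset.sum_congr rfl fun i _ => ?_
    congr 1; push_cast; ring

lemma telescope_zero (h : ∀ x, Φ (x + 1) = Φ x + φ x) (h0 : φ 0 = 0) (k : ℕ) :
    Φ (1 + k) = Φ 0 + ∑ i ∈ Finset.range k, φ (i + 1) := by
  have := telescope_add h (ε := 0) (by simpa using h0) 0 k
  simpa using this

end Telescoping

/-! ### Values of the paired Pochhammer products. -/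

section PairValues

lemma prod_single_eq {R : Type*} [CommRing R] (ε : R) (a k : ℕ) :
    (∏ i ∈ (Finset.range k).erase a, (-a + ε + i)) *
        ∏ i ∈ (Finset.range (a + 1)).erase k, ((k : R) - i + ε) =
      (-1) ^ a * (∏ i ∈ Finset.range a, ((i : R) + 1 - ε)) * ∏ i ∈ Finset.range k, (i + 1 + ε) := by
  have h := prod_erase_mul_prod_erase (fun n : ℤ => (n : R) + ε) a k
  have h1 : ∏ i ∈ Finset.range a, (((-(i + 1) : ℤ) : R) + ε) =
      (-1) ^ a * ∏ i ∈ Finset.range a, ((i : R) + 1 - ε) := by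
    rw [← Finset.card_range a, ← Finset.prod_const, Finset.card_range, ← Finset.prod_mul_distrib]
    refine Finset.prod_congr rfl fun i _ => ?_
    push_cast; ring
  rw [h1] at h
  push_cast at h
  rw [← h]
  congr 1
  exact Finset.prod_congr rfl fun i _ => by ring

/-- For x = -a + ε and its partner 1 - x, the factors i + 1 + ε and i + 1 - ε combine to (i + 1)² -
ε², with no linear term in ε. This makes the identification of the coefficients exact modulo p² when
ε is divisible by p. -/
lemma prod_pair_eq {R : Type*} [CommRing R] (ε : R) (a k : ℕ)
    (hE : IsUnit (∏ i ∈ Finset.range a, ((i : R) + 1 - ε))) :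
    (∏ i ∈ (Finset.range k).erase a, (-a + ε + i)) * (∏ i ∈ Finset.range k, (1 + a - ε + i)) *
        ∏ i ∈ (Finset.range (a + 1)).erase k, ((k : R) - i + ε) =
      (-1) ^ a * (∏ i ∈ Finset.range a, ((k : R) + i + 1 - ε)) *
        ∏ i ∈ Finset.range k, (((i : R) + 1) ^ 2 - ε ^ 2) := by
  have h1 := prod_single_eq ε a k
  have h2 := prod_range_mul_prod_range (fun n : ℕ => (n : R) + 1 - ε) a k
  have h3 : ∏ i ∈ Finset.range k, (((i : R) + 1) ^ 2 - ε ^ 2) =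
      (∏ i ∈ Finset.range k, ((i : R) + 1 + ε)) * ∏ i ∈ Finset.range k, ((i : R) + 1 - ε) := by
    rw [← Finset.prod_mul_distrib]
    exact Finset.prod_congr rfl fun i _ => by ring
  have h4 : ∏ i ∈ Finset.range k, (1 + a - ε + i) =
      ∏ i ∈ Finset.range k, (((a + i : ℕ) : R) + 1 - ε) :=
    Finset.prod_congr rfl fun i _ => by push_cast; ring
  -- The product over i < a of i + 1 - ε occurs in both auxiliary identities and cancels only
  -- because it is a unit.
  refine hE.mul_left_cancel ?_
  rw [h3, h4]
  push_cast at h2 ⊢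
  linear_combination (∏ i ∈ Finset.range k, ((a : R) + i + 1 - ε)) *
    (∏ i ∈ Finset.range a, ((i : R) + 1 - ε)) * h1 +
    (-1) ^ a * (∏ i ∈ Finset.range a, ((i : R) + 1 - ε)) *
    (∏ i ∈ Finset.range k, ((i : R) + 1 + ε)) * h2

end PairValues

/-! ### Congruences for inverses and for telescoped logarithmic derivatives. -/

section Inverses

variable {p : ℕ} [Fact p.Prime]

lemma isUnit_sub_add {i k : ℕ} (hi : i < p) (hk : k < p) (hik : i ≠ k) (y : ℤ_[p]) :
    IsUnit ((k : ℤ_[p]) - i + p * y) := by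
  by_contra h
  rw [PadicInt.not_isUnit_iff, PadicInt.norm_lt_one_iff_dvd, dvd_add_left (dvd_mul_right _ _)] at h
  have h1 : ((k : ℤ_[p]) - i) = ((k - i : ℤ) : ℤ_[p]) := by push_cast; rfl
  rw [h1, ← PadicInt.norm_lt_one_iff_dvd, PadicInt.norm_intCast_lt_one_iff] at h
  have := Int.eq_zero_of_abs_lt_dvd h (by rw [abs_lt]; omega)
  omega

lemma isUnit_natCast_add {c : ℕ} (h0 : 0 < c) (hc : c < p) (y : ℤ_[p]) :
    IsUnit ((c : ℤ_[p]) + p * y) := by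
  rw [add_comm]
  exact (isUnit_mul_add_natCast_iff hc).2 h0.ne'

lemma mul_inv_of_isUnit {z : ℤ_[p]} (h : IsUnit z) : z * z.inv = 1 :=
  PadicInt.mul_inv (PadicInt.isUnit_iff.1 h)

lemma inv_mul_eq_zero (y : ℤ_[p]) : (p * y : ℤ_[p]).inv = 0 :=
  inv_of_not_isUnit fun h => PadicInt.prime_p.not_isUnit (isUnit_of_mul_isUnit_left h)

lemma dvd_inv_add_sub_inv (z y : ℤ_[p]) : (p : ℤ_[p]) ∣ (z + p * y).inv - z.inv := by
  have h : IsUnit (z + p * y) ↔ IsUnit z := by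
    rw [← not_iff_not, PadicInt.not_isUnit_iff, PadicInt.not_isUnit_iff,
      PadicInt.norm_lt_one_iff_dvd, PadicInt.norm_lt_one_iff_dvd,
      dvd_add_left (dvd_mul_right _ _)]
  by_cases hz : IsUnit z
  · have h1 := mul_inv_of_isUnit hz
    have h2 := mul_inv_of_isUnit (h.2 hz)
    exact ⟨-y * (z + p * y).inv * z.inv, by
      linear_combination z.inv * h2 - (z + p * y).inv * h1⟩
  · rw [inv_of_not_isUnit hz, inv_of_not_isUnit (mt h.1 hz), sub_zero]
    exact dvd_zero _

lemma dvd_neg_inv_sq_sub (z y : ℤ_[p]) :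
    (p : ℤ_[p]) ∣ -(z + p * y).inv ^ 2 - -z.inv ^ 2 := by
  have := (dvd_inv_add_sub_inv z y).mul_right (-((z + p * y).inv + z.inv))
  convert this using 1
  ring

/-- The first-order terms in py cancel between the two signs. -/
lemma sq_dvd_inv_add_inv_sub {c : ℕ} (h0 : 0 < c) (hc : c < p) (y : ℤ_[p]) :
    (p : ℤ_[p]) ^ 2 ∣ (c + p * y : ℤ_[p]).inv + (c - p * y : ℤ_[p]).inv - 2 * (c : ℤ_[p]).inv := by
  have h1 := mul_inv_of_isUnit (isUnit_natCast_add h0 hc y)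
  have h2 := mul_inv_of_isUnit (isUnit_natCast_add h0 hc (-y))
  have h3 := mul_inv_of_isUnit (isUnit_natCast_add h0 hc (0 : ℤ_[p]))
  rw [mul_neg, ← sub_eq_add_neg] at h2
  rw [mul_zero, add_zero] at h3
  generalize (c + p * y : ℤ_[p]).inv = u at *
  generalize (c - p * y : ℤ_[p]).inv = v at *
  generalize (c : ℤ_[p]).inv = w at *
  exact ⟨2 * y ^ 2 * u * v * w, by
    linear_combination (-v + 2 * w * (c - p * y) * v) * h1 + (-u + 2 * w) * h2
      + (- 2 * c * u * v) * h3⟩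

variable {Φ φ : ℤ_[p] → ℤ_[p]}

lemma dvd_telescope_sub (h : ∀ x, Φ (x + 1) = Φ x + φ x) (h0 : ∀ y, φ (p * y) = 0)
    (hφ : ∀ z y, (p : ℤ_[p]) ∣ φ (z + p * y) - φ z) (hΦ : ∀ y, (p : ℤ_[p]) ∣ Φ (p * y) - Φ 0)
    (y : ℤ_[p]) (a k : ℕ) : (p : ℤ_[p]) ∣ Φ (-a + p * y + k) - Φ (1 + k) +
      ∑ i ∈ (Finset.range (a + 1)).erase k, φ ((k : ℤ_[p]) - i + p * y) := by
  have h1 := telescope_sub h (h0 y) a k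
  have h2 := telescope_zero h (by simpa using h0 0) k
  have h3 := dvd_add (hΦ y) (Finset.dvd_sum fun i (_ : i ∈ Finset.range k) => hφ (i + 1) y)
  rw [Finset.sum_sub_distrib] at h3
  convert h3 using 1
  linear_combination h1 - h2

lemma dvd_telescope_add (h : ∀ x, Φ (x + 1) = Φ x + φ x) (h0 : ∀ y, φ (p * y) = 0)
    (hφ : ∀ z y, (p : ℤ_[p]) ∣ φ (z + p * y) - φ z) (hΦ : ∀ y, (p : ℤ_[p]) ∣ Φ (p * y) - Φ 0)
    (y : ℤ_[p]) (a k : ℕ) : (p : ℤ_[p]) ∣ Φ (1 + a - p * y + k) - Φ (1 + k) -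
      ∑ i ∈ Finset.range a, φ ((k : ℤ_[p]) + i + 1 - p * y) := by
  have h1 := telescope_add h (ε := p * y) (by simpa using h0 (-y)) a k
  have h2 := telescope_zero h (by simpa using h0 0) k
  have h3 := dvd_add (hΦ (-y)) (Finset.dvd_sum fun i (_ : i ∈ Finset.range k) => hφ (i + 1) (-y))
  rw [Finset.sum_sub_distrib] at h3
  simp only [mul_neg, ← sub_eq_add_neg] at h3
  convert h3 using 1
  linear_combination h1 - h2

/-- A single parameter gives a congruence only modulo p; adding the partner 1 - x makes the
first-order errors cancel, which gives p². -/
lemma sq_dvd_telescope_pair {G : ℤ_[p] → ℤ_[p]} (h : ∀ x, G (x + 1) = G x + x.inv)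
    (hG : ∀ y, (p : ℤ_[p]) ^ 2 ∣ G (p * y) - G 0) (y : ℤ_[p]) (a : ℕ) {k : ℕ} (hk : k < p) :
    (p : ℤ_[p]) ^ 2 ∣ G (-a + p * y + k) + G (1 + a - p * y + k) - 2 * G (1 + k) +
      ∑ i ∈ (Finset.range (a + 1)).erase k, ((k : ℤ_[p]) - i + p * y).inv -
      ∑ i ∈ Finset.range a, ((k : ℤ_[p]) + i + 1 - p * y).inv := by
  have h0 : ∀ y : ℤ_[p], (p * y : ℤ_[p]).inv = 0 := inv_mul_eq_zero
  have h1 := telescope_sub h (h0 y) a k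
  have h2 := telescope_add h (ε := p * y) (by simpa using h0 (-y)) a k
  have h3 := telescope_zero h (by simpa using h0 0) k
  have h4 := dvd_add (dvd_add (hG y) (hG (-y)))
    (Finset.dvd_sum fun i (hi : i ∈ Finset.range k) => sq_dvd_inv_add_inv_sub (p := p)
      (Nat.succ_pos i) (by rw [Finset.mem_range] at hi; omega) y)
  rw [Finset.sum_sub_distrib, Finset.sum_add_distrib, ← Finset.mul_sum] at h4
  simp only [mul_neg, Nat.cast_succ] at h4
  convert h4 using 1
  linear_combination h1 + h2 - 2 * h3

end Inverses

/-! ### Jets of the numerators and denominators. -/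

section JetProducts

open Polynomial

variable {p : ℕ} [Fact p.Prime] {S : Type*} [CommRing S] (π : ℤ_[p] →+* S)

lemma isJet_coNodeFactor {h : S} (h2 : 2 * h = 1) {J : Type*} [Fintype J] {a : J → ℕ}
    (y : J → ℤ_[p]) (ha : ∀ j, a j < p) {k : ℕ} (hk : k < p) :
    IsJet h (X - C (k : S)) (coNodeFactor a (fun j => π (p * y j)) k)
      (π (∏ j, ∏ i ∈ (Finset.range (a j + 1)).erase k, ((k : ℤ_[p]) - i + p * y j)))
      (π (∑ j, ∑ i ∈ (Finset.range (a j + 1)).erase k, ((k : ℤ_[p]) - i + p * y j).inv))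
      (π (∑ j, ∑ i ∈ (Finset.range (a j + 1)).erase k, -((k : ℤ_[p]) - i + p * y j).inv ^ 2)) := by
  simp only [map_prod, map_sum]
  refine IsJet.prod h2 fun j _ => IsJet.prod h2 fun i hi => ?_
  rw [Finset.mem_erase, Finset.mem_range] at hi
  have hu := mul_inv_of_isUnit (isUnit_sub_add (by have := ha j; omega) hk hi.1 (y j))
  have := isJet_add_C h (X - C (k : S)) (by rw [← map_mul, hu, map_one] :
    π ((k : ℤ_[p]) - i + p * y j) * π (((k : ℤ_[p]) - i + p * y j).inv) = 1)
  convert this using 1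
  · simp only [map_add, map_sub, map_natCast]
    ring
  · simp

lemma isJet_prod_add {h : S} (h2 : 2 * h = 1) (y : ℤ_[p]) {a k : ℕ} (hk : k + a < p) :
    IsJet h (X - C (k : S)) (∏ i ∈ Finset.range a, (X - C (π (p * y - (i + 1)))))
      (π (∏ i ∈ Finset.range a, ((k : ℤ_[p]) + i + 1 - p * y)))
      (π (∑ i ∈ Finset.range a, ((k : ℤ_[p]) + i + 1 - p * y).inv))
      (π (∑ i ∈ Finset.range a, -((k : ℤ_[p]) + i + 1 - p * y).inv ^ 2)) := by
  simp only [map_prod, map_sum]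
  refine IsJet.prod h2 fun i hi => ?_
  rw [Finset.mem_range] at hi
  have h1 : (k : ℤ_[p]) + i + 1 - p * y = ((k + i + 1 : ℕ) : ℤ_[p]) + p * (-y) := by
    push_cast; ring
  have hu := mul_inv_of_isUnit (isUnit_natCast_add (by omega : 0 < k + i + 1) (by omega) (-y))
  rw [← h1] at hu
  have := isJet_add_C h (X - C (k : S)) (by rw [← map_mul, hu, map_one] :
    π ((k : ℤ_[p]) + i + 1 - p * y) * π (((k : ℤ_[p]) + i + 1 - p * y).inv) = 1)
  convert this using 1
  · simp only [map_add, map_sub, map_natCast, map_one]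
    ring
  · simp

end JetProducts

end Companion

/-! ### Residue sums for the hypergeometric coefficients. -/

namespace Companion

open Polynomial

/-- Parameters `xⱼ = -aⱼ + p yⱼ` in `ℤ_p`, symmetric under `x ↦ 1 - x`, with the coefficients `A`
of the hypergeometric series freed of powers of `p`, and the logarithmic derivatives `G`, `H`. -/
structure PairedData (p : ℕ) [Fact p.Prime] where
  a : Fin 4 → ℕ
  x : Fin 4 → ℤ_[p]
  y : Fin 4 → ℤ_[p]
  A : ℕ → ℤ_[p]
  G : ℤ_[p] → ℤ_[p]
  H : ℤ_[p] → ℤ_[p]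
  ne_two : p ≠ 2
  x_eq : ∀ j, x j = -a j + p * y j
  x_two : x 2 = 1 - x 1
  x_three : x 3 = 1 - x 0
  a_le₀ : a 0 ≤ a 1
  a_le₁ : a 1 ≤ a 2
  a_le₂ : a 2 ≤ a 3
  a_add₀ : a 0 + a 3 + 1 = p
  a_add₁ : a 1 + a 2 + 1 = p
  A_spec : ∀ k < p, (k.factorial : ℤ_[p]) ^ 4 * A k =
    ∏ j, ∏ i ∈ (Finset.range k).erase (a j), (x j + i)
  G_add_one : ∀ x, G (x + 1) = G x + x.inv
  H_add_one : ∀ x, H (x + 1) = H x - x.inv ^ 2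
  G_dvd : ∀ y, (p : ℤ_[p]) ^ 2 ∣ G (p * y) - G 0
  H_dvd : ∀ y, (p : ℤ_[p]) ∣ H (p * y)

namespace PairedData

variable {p : ℕ} [Fact p.Prime] (D : PairedData p)

/-- The first logarithmic derivative of the coefficients. -/
noncomputable def logDeriv₁ (k : ℕ) : ℤ_[p] := ∑ j, (D.G (D.x j + k) - D.G (1 + k))

/-- The derivative of the first logarithmic derivative of the coefficients. -/
noncomputable def logDeriv₂ (k : ℕ) : ℤ_[p] := ∑ j, (D.H (D.x j + k) - D.H (1 + k))

/-- The sign `(-1)^(a₁ + a₂)`. -/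
noncomputable def sign : ℤ_[p] := (-1) ^ (D.a 0 + D.a 1)

lemma x_zero_add (k : ℕ) : D.x 0 + k = -D.a 0 + p * D.y 0 + k := by rw [D.x_eq]
lemma x_one_add (k : ℕ) : D.x 1 + k = -D.a 1 + p * D.y 1 + k := by rw [D.x_eq]
lemma x_two_add (k : ℕ) : D.x 2 + k = 1 + D.a 1 - p * D.y 1 + k := by
  rw [D.x_two, D.x_eq]; ring
lemma x_three_add (k : ℕ) : D.x 3 + k = 1 + D.a 0 - p * D.y 0 + k := by
  rw [D.x_three, D.x_eq]; ring

lemma isUnit_prod (y : ℤ_[p]) {a : ℕ} (ha : a < p) :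
    IsUnit (∏ i ∈ Finset.range a, ((i : ℤ_[p]) + 1 - p * y)) := by
  rw [IsUnit.prod_iff]
  intro i hi
  rw [Finset.mem_range] at hi
  have := isUnit_natCast_add (Nat.succ_pos i) (by omega : i + 1 < p) (-y)
  rwa [show ((i.succ : ℕ) : ℤ_[p]) + p * -y = i + 1 - p * y by push_cast; ring] at this

lemma isUnit_factorial {k : ℕ} (hk : k < p) : IsUnit (k.factorial : ℤ_[p]) := by
  rw [PadicInt.isUnit_iff, PadicInt.norm_natCast_eq_one_iff]
  exact ((Fact.out : p.Prime).coprime_factorial_of_lt hk)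

/-- Identifies the sign times A_k with numerator over regular part of the denominator, up to the
last product, which is k!⁴ modulo p². As k ≤ a 1, nothing is erased for the indices 2 and 3. -/
lemma A_mul_prod {k : ℕ} (hk : k ≤ D.a 1) :
    (k.factorial : ℤ_[p]) ^ 4 * (D.A k * ∏ j : Fin 2,
        ∏ i ∈ (Finset.range (![D.a 0, D.a 1] j + 1)).erase k,
          ((k : ℤ_[p]) - i + p * ![D.y 0, D.y 1] j)) =
      D.sign * (∏ j : Fin 2, ∏ i ∈ Finset.range (![D.a 0, D.a 1] j),
          ((k : ℤ_[p]) + i + 1 - p * ![D.y 0, D.y 1] j)) *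
        ∏ j : Fin 2, ∏ i ∈ Finset.range k, (((i : ℤ_[p]) + 1) ^ 2 - (p * ![D.y 0, D.y 1] j) ^ 2) := by
  have h1 := D.a_le₁
  have h2 := D.a_le₂
  have h3 := D.a_add₀
  have h4 := D.a_add₁
  have e0 := prod_pair_eq (p * D.y 0) (D.a 0) k (isUnit_prod (D.y 0) (by omega))
  have e1 := prod_pair_eq (p * D.y 1) (D.a 1) k (isUnit_prod (D.y 1) (by omega))
  have hA := D.A_spec k (by omega)
  rw [Fin.prod_univ_four, Finset.erase_eq_of_notMem (a := D.a 2) (by simp; omega),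
    Finset.erase_eq_of_notMem (a := D.a 3) (by simp; omega)] at hA
  simp only [x_zero_add, x_one_add, x_two_add, x_three_add] at hA
  simp only [Fin.prod_univ_two, Matrix.cons_val_zero, Matrix.cons_val_one, sign]
  rw [← mul_assoc, hA, pow_add]
  linear_combination (∏ i ∈ (Finset.range k).erase (D.a 1), (-D.a 1 + p * D.y 1 + i : ℤ_[p])) *
    (∏ i ∈ Finset.range k, (1 + D.a 1 - p * D.y 1 + i : ℤ_[p])) *
    (∏ i ∈ (Finset.range (D.a 1 + 1)).erase k, ((k : ℤ_[p]) - i + p * D.y 1)) * e0 +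
    (-1) ^ D.a 0 * (∏ i ∈ Finset.range (D.a 0), ((k : ℤ_[p]) + i + 1 - p * D.y 0)) *
    (∏ i ∈ Finset.range k, (((i : ℤ_[p]) + 1) ^ 2 - (p * D.y 0) ^ 2)) * e1

lemma exists_half (D : PairedData p) : ∃ t : ℤ_[p], 2 * t = 1 := by
  have h : IsUnit ((2 : ℕ) : ℤ_[p]) := by
    rw [PadicInt.isUnit_iff, PadicInt.norm_natCast_eq_one_iff]
    exact (Nat.coprime_primes Fact.out Nat.prime_two).2 D.ne_two
  obtain ⟨t, ht⟩ := h.exists_right_inv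
  exact ⟨t, by exact_mod_cast ht⟩

theorem sq_dvd_sum_sub_sign {J₂ : ℕ → ℤ_[p]}
    (hJ : ∀ k, 2 * J₂ k = D.logDeriv₁ k ^ 2 + D.logDeriv₂ k) : (p : ℤ_[p]) ^ 2 ∣
    ∑ k ∈ Finset.range (D.a 1 + 1), (if k ≤ D.a 0 then
        k * (D.A k * D.logDeriv₁ k) + D.A k
          - p * (D.y 0 + D.y 1) * (k * (D.A k * J₂ k) + D.A k * D.logDeriv₁ k)
      else k * D.A k - p * D.y 1 * (k * (D.A k * D.logDeriv₁ k) + D.A k)) - D.sign := by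
  have h1 := D.a_le₁
  have h2 := D.a_le₂
  have h3 := D.a_add₀
  have h4 := D.a_add₁
  have h5 := D.a_le₀
  obtain ⟨t, ht⟩ := D.exists_half
  have hp := (Fact.out : p.Prime)
  let I : Ideal ℤ_[p] := Ideal.span {(p : ℤ_[p]) ^ 2}
  let π : ℤ_[p] →+* ℤ_[p] ⧸ I := Ideal.Quotient.mk I
  have hπ : ∀ z, π z = 0 ↔ (p : ℤ_[p]) ^ 2 ∣ z := fun z => by
    rw [Ideal.Quotient.eq_zero_iff_mem, Ideal.mem_span_singleton]
  have hnt : Nontrivial (ℤ_[p] ⧸ I) := by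
    rw [Ideal.Quotient.nontrivial_iff, Ne, Ideal.span_singleton_eq_top]
    exact fun h => PadicInt.prime_p.not_isUnit (isUnit_of_dvd_unit (dvd_pow_self _ two_ne_zero) h)
  have hsign : D.sign * D.sign = 1 := by rw [sign, ← pow_add, ← two_mul, pow_mul]; simp
  set a : Fin 2 → ℕ := ![D.a 0, D.a 1] with ha
  set y : Fin 2 → ℤ_[p] := ![D.y 0, D.y 1] with hy
  have ha0 : a 0 = D.a 0 := rfl
  have ha1 : a 1 = D.a 1 := rfl
  have haj : ∀ j, a j ≤ D.a 1 := fun j => by fin_cases j <;> simp [ha, h5]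
  have h2π : 2 * π t = 1 := by rw [← map_ofNat π 2, ← map_mul, ht, map_one]
  set N : (ℤ_[p] ⧸ I)[X] := ∏ j, ∏ i ∈ Finset.range (a j), (X - C (π (p * y j - (i + 1)))) with hN
  set mN : ℕ → ℤ_[p] := fun k => ∑ j, ∑ i ∈ Finset.range (a j),
    -((k : ℤ_[p]) + i + 1 - p * y j).inv ^ 2 with hmN
  set mD : ℕ → ℤ_[p] := fun k => ∑ j, ∑ i ∈ (Finset.range (a j + 1)).erase k,
    -((k : ℤ_[p]) - i + p * y j).inv ^ 2 with hmD
  have hee : ∀ z w : ℤ_[p], π (p * z) * π (p * w) = 0 := fun z w => by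
    rw [← map_mul, hπ]; exact ⟨z * w, by ring⟩
  have key := sum_jet_two_eq (h := π t) (a := a) (e := fun j => π (p * y j)) (N := N)
    (u := fun k => π (D.sign * D.A k)) (l := fun k => π (D.logDeriv₁ k))
    (m := fun k => π (mN k - mD k)) (by simpa [ha] using h5) (fun i j => hee _ _)
    (fun k hk l hl hkl i j => ?_) (monic_prod_of_monic _ _ fun j _ =>
      monic_prod_of_monic _ _ fun i _ => monic_X_sub_C _) ?_ (fun k hk => ?_)
  -- The second logarithmic derivative enters only with a factor p, so it is needed only modulo p,
  -- where it agrees with `logDeriv₂`.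
  · have hm : ∀ k ≤ a 1, ∀ z : ℤ_[p],
        π (p * z) * π t * π (mN k - mD k) = π (p * z) * π t * π (D.logDeriv₂ k) := by
      intro k hk z
      rw [← sub_eq_zero, ← mul_sub, ← map_sub, ← map_mul, ← map_mul, hπ]
      have f1 := fun (a : ℕ) (y : ℤ_[p]) => dvd_telescope_sub (Φ := D.H) (φ := fun z => -z.inv ^ 2)
        (fun x => by rw [D.H_add_one]; ring) (fun y => by rw [inv_mul_eq_zero]; ring)
        dvd_neg_inv_sq_sub (fun y => dvd_sub (D.H_dvd y) (by simpa using D.H_dvd 0)) y a k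
      have f2 := fun (a : ℕ) (y : ℤ_[p]) => dvd_telescope_add (Φ := D.H) (φ := fun z => -z.inv ^ 2)
        (fun x => by rw [D.H_add_one]; ring) (fun y => by rw [inv_mul_eq_zero]; ring)
        dvd_neg_inv_sq_sub (fun y => dvd_sub (D.H_dvd y) (by simpa using D.H_dvd 0)) y a k
      obtain ⟨w, hw⟩ := dvd_add (dvd_add (f1 (a 0) (y 0)) (f2 (a 0) (y 0)))
        (dvd_add (f1 (a 1) (y 1)) (f2 (a 1) (y 1)))
      refine ⟨-z * t * w, ?_⟩
      simp only [hmN, hmD, logDeriv₂, Fin.sum_univ_two, Fin.sum_univ_four, x_zero_add, x_one_add,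
        x_two_add, x_three_add, ← ha0, ← ha1, show D.y 0 = y 0 from rfl, show D.y 1 = y 1 from rfl]
      linear_combination -p * z * t * hw
    rw [← hπ, map_sub, map_sum, sub_eq_zero]
    -- The jets have value sign · A_k; multiplying the residue sum 1 by the sign frees A_k, since
    -- the sign squares to 1.
    have key2 := congrArg (π D.sign * ·) key
    simp only [mul_one, Finset.mul_sum] at key2
    rw [← key2]
    refine Finset.sum_congr rfl fun k hk => ?_
    have hk1 : k ≤ a 1 := by rw [Finset.mem_range] at hk; omega
    have hss : π D.sign * π D.sign = 1 := by rw [← map_mul, hsign, map_one]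
    have hJ2 : ∀ z : ℤ_[p], π (p * z) * (π t * (π (D.logDeriv₁ k) ^ 2 + π (mN k - mD k))) =
        π (p * z) * π (J₂ k) := fun z => by
      have h6 : J₂ k = t * (D.logDeriv₁ k ^ 2 + D.logDeriv₂ k) := by
        rw [← hJ]; linear_combination (-J₂ k) * ht
      rw [h6, map_mul π t, map_add, map_pow]
      linear_combination hm k hk1 z
    have hJ0 := hJ2 (y 0)
    have hJ1 := hJ2 (y 1)
    simp only [map_mul, map_natCast] at hJ0 hJ1
    generalize π (mN k - mD k) = μ at *
    by_cases hk0 : k ≤ D.a 0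
    · rw [if_pos hk0, if_pos (show k ≤ a 0 from hk0)]
      simp only [map_add, map_sub, map_mul, map_natCast, ← show y 0 = D.y 0 from rfl,
        ← show y 1 = D.y 1 from rfl]
      linear_combination (-(π (D.A k) * ((k * π (D.logDeriv₁ k) + 1) - (p * π (y 0) + p * π (y 1)) *
        (k * (π t * (π (D.logDeriv₁ k) ^ 2 + μ)) + π (D.logDeriv₁ k))))) * hss +
        π (D.A k) * k * (hJ0 + hJ1)
    · rw [if_neg hk0, if_neg (show ¬ k ≤ a 0 from hk0)]
      simp only [map_add, map_sub, map_mul, map_natCast, ← show y 1 = D.y 1 from rfl]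
      linear_combination (-(π (D.A k) * (k - p * π (y 1) * (k * π (D.logDeriv₁ k) + 1)))) * hss
  · have := (isUnit_sub_add (i := l) (k := k) (by omega) (by omega) hkl.symm (y j - y i)).map π
    convert this using 1
    simp only [map_add, map_sub, map_mul, map_natCast]
    ring
  · rw [natDegree_prod_of_monic _ _ fun j _ => monic_prod_of_monic _ _ fun i _ => monic_X_sub_C _,
      Fin.sum_univ_two, natDegree_prod_of_monic _ _ fun i _ => monic_X_sub_C _,
      natDegree_prod_of_monic _ _ fun i _ => monic_X_sub_C _]
    simp only [natDegree_X_sub_C]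
    simp
  · have hkp : k < p := by omega
    refine IsJet.dvd_mul_jet_sub h2π (isJet_coNodeFactor π h2π y
      (fun j => (haj j).trans_lt (by omega)) hkp) (IsJet.prod h2π fun j _ => isJet_prod_add π h2π (y j)
      (by have := haj j; omega)) ?_ ?_ ?_
    · have hu : IsUnit (π (k.factorial ^ 4)) := ((isUnit_factorial hkp).pow 4).map π
      have hA := D.A_mul_prod hk
      refine hu.mul_left_cancel ?_
      have hsq : π (∏ j : Fin 2, ∏ i ∈ Finset.range k, (((i : ℤ_[p]) + 1) ^ 2 - (p * y j) ^ 2)) =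
          π (k.factorial ^ 4) := by
        have h7 : ∀ j, π (∏ i ∈ Finset.range k, (((i : ℤ_[p]) + 1) ^ 2 - (p * y j) ^ 2)) =
            π (k.factorial ^ 2) := fun j => by
          rw [← Finset.prod_range_add_one_eq_factorial]
          push_cast
          rw [← Finset.prod_pow, map_prod, map_prod]
          refine Finset.prod_congr rfl fun i _ => ?_
          rw [map_sub, map_pow π (p * y j), pow_two (π (p * y j)), hee, sub_zero]
        rw [map_prod, Fin.prod_univ_two, h7, h7, ← map_mul]
        congr 1; ring
      have hA := congrArg π hA
      rw [map_mul π _ (∏ j : Fin 2, ∏ i ∈ Finset.range k, _), hsq, map_mul π _ (D.A k * _),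
        map_mul π (D.A k), map_mul π D.sign] at hA
      rw [map_mul π D.sign, ← map_prod]
      have hss : π D.sign * π D.sign = 1 := by rw [← map_mul, hsign, map_one]
      linear_combination π D.sign * hA + π (k.factorial ^ 4) *
        π (∏ j, ∏ i ∈ Finset.range (a j), ((k : ℤ_[p]) + i + 1 - p * y j)) * hss
    · rw [← map_sum, ← map_add, ← sub_eq_zero, ← map_sub, hπ]
      have e0 := sq_dvd_telescope_pair D.G_add_one D.G_dvd (y 0) (a 0) hkp
      have e1 := sq_dvd_telescope_pair D.G_add_one D.G_dvd (y 1) (a 1) hkp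
      convert dvd_add e0 e1 using 1
      simp only [logDeriv₁, Fin.sum_univ_two, Fin.sum_univ_four, x_zero_add, x_one_add,
        x_two_add, x_three_add, ← ha0, ← ha1, show D.y 0 = y 0 from rfl, show D.y 1 = y 1 from rfl]
      ring
    · rw [← map_sum, ← map_add]
      congr 1
      simp only [hmN, hmD]
      ring

/-- Here the index 2 gives its own family of poles instead of being the partner of index 1. The two
unpaired families leave a constant independent of k and products that become k! modulo p. -/
lemma A_mul_prod_three {k : ℕ} (hk : k ≤ D.a 2) :
    (k.factorial : ℤ_[p]) ^ 4 * (D.A k * ∏ j : Fin 3,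
        ∏ i ∈ (Finset.range (![D.a 0, D.a 1, D.a 2] j + 1)).erase k,
          ((k : ℤ_[p]) - i + p * ![D.y 0, D.y 1, D.y 2] j)) =
      ((-1) ^ (D.a 0 + D.a 1 + D.a 2) * (∏ i ∈ Finset.range (D.a 1), ((i : ℤ_[p]) + 1 - p * D.y 1)) *
          ∏ i ∈ Finset.range (D.a 2), ((i : ℤ_[p]) + 1 - p * D.y 2)) *
        (∏ i ∈ Finset.range (D.a 0), ((k : ℤ_[p]) + i + 1 - p * D.y 0)) *
        ((∏ i ∈ Finset.range k, (((i : ℤ_[p]) + 1) ^ 2 - (p * D.y 0) ^ 2)) *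
          (∏ i ∈ Finset.range k, (i + 1 + p * D.y 1)) *
          ∏ i ∈ Finset.range k, (i + 1 + p * D.y 2)) := by
  have h2 := D.a_le₂
  have h3 := D.a_add₀
  have h4 := D.a_add₁
  have e0 := prod_pair_eq (p * D.y 0) (D.a 0) k (isUnit_prod (D.y 0) (by omega))
  have e1 := prod_single_eq (p * D.y 1) (D.a 1) k
  have e2 := prod_single_eq (p * D.y 2) (D.a 2) k
  have hA := D.A_spec k (by omega)
  have hx2 : ∀ k : ℕ, D.x 2 + k = -D.a 2 + p * D.y 2 + k := fun k => by rw [D.x_eq]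
  rw [Fin.prod_univ_four, Finset.erase_eq_of_notMem (a := D.a 3) (by simp; omega)] at hA
  simp only [x_zero_add, x_one_add, hx2, x_three_add] at hA
  simp only [Fin.prod_univ_three, Matrix.cons_val_zero, Matrix.cons_val_one, Matrix.cons_val]
  rw [← mul_assoc, hA, pow_add, pow_add]
  generalize (∏ i ∈ (Finset.range k).erase (D.a 0), (-D.a 0 + p * D.y 0 + i : ℤ_[p])) = b0 at *
  generalize (∏ i ∈ (Finset.range k).erase (D.a 1), (-D.a 1 + p * D.y 1 + i : ℤ_[p])) = b1 at *
  generalize (∏ i ∈ (Finset.range k).erase (D.a 2), (-D.a 2 + p * D.y 2 + i : ℤ_[p])) = b2 at *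
  generalize (∏ i ∈ Finset.range k, (1 + D.a 0 - p * D.y 0 + i : ℤ_[p])) = b3 at *
  generalize (∏ i ∈ (Finset.range (D.a 0 + 1)).erase k, ((k : ℤ_[p]) - i + p * D.y 0)) = d0 at *
  generalize (∏ i ∈ (Finset.range (D.a 1 + 1)).erase k, ((k : ℤ_[p]) - i + p * D.y 1)) = d1 at *
  generalize (∏ i ∈ (Finset.range (D.a 2 + 1)).erase k, ((k : ℤ_[p]) - i + p * D.y 2)) = d2 at *
  rw [show b0 * b1 * b2 * b3 * (d0 * d1 * d2) = b0 * b3 * d0 * (b1 * d1) * (b2 * d2) by ring,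
    e0, e1, e2]
  ring

lemma map_prod_range_eq_factorial {S : Type*} [CommRing S] (π : ℤ_[p] →+* S)
    (hπ : ∀ z, π (p * z) = 0) (y : ℤ_[p]) (k : ℕ) :
    π (∏ i ∈ Finset.range k, (i + 1 + p * y)) = π k.factorial := by
  rw [← Finset.prod_range_add_one_eq_factorial]
  push_cast
  rw [map_prod, map_prod]
  refine Finset.prod_congr rfl fun i _ => ?_
  rw [map_add, hπ, add_zero]

/-- The residue identity modulo p for X^n. The q_i are the Taylor coefficients of X^n at k; `hq` is
asked over every ring so that it can be used in a polynomial ring. -/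
theorem dvd_sum_jet {J₂ : ℕ → ℤ_[p]}
    (hJ : ∀ k, 2 * J₂ k = D.logDeriv₁ k ^ 2 + D.logDeriv₂ k) {n : ℕ} (hn : n ≤ 2)
    {q₀ q₁ q₂ : ℕ → ℤ_[p]} (hq : ∀ (S : Type) [CommRing S] (π : ℤ_[p] →+* S) (k : ℕ) (x : S),
      (x + k) ^ n = π (q₀ k) + π (q₁ k) * x + π (q₂ k) * x ^ 2) : (p : ℤ_[p]) ∣
    ∑ k ∈ Finset.range (D.a 2 + 1), (if k ≤ D.a 0 then
        q₀ k * (D.A k * J₂ k) + q₁ k * (D.A k * D.logDeriv₁ k) + q₂ k * D.A k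
      else if k ≤ D.a 1 then q₀ k * (D.A k * D.logDeriv₁ k) + q₁ k * D.A k
      else q₀ k * D.A k) := by
  have h1 := D.a_le₁
  have h2 := D.a_le₂
  have h3 := D.a_add₀
  have h4 := D.a_add₁
  have h5 := D.a_le₀
  obtain ⟨t, ht⟩ := D.exists_half
  have hp := (Fact.out : p.Prime)
  let I : Ideal ℤ_[p] := Ideal.span {(p : ℤ_[p])}
  let π : ℤ_[p] →+* ℤ_[p] ⧸ I := Ideal.Quotient.mk I
  have hπ : ∀ z, π z = 0 ↔ (p : ℤ_[p]) ∣ z := fun z => by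
    rw [Ideal.Quotient.eq_zero_iff_mem, Ideal.mem_span_singleton]
  have hnt : Nontrivial (ℤ_[p] ⧸ I) := by
    rw [Ideal.Quotient.nontrivial_iff, Ne, Ideal.span_singleton_eq_top]
    exact PadicInt.prime_p.not_isUnit
  have hε : ∀ z, π (p * z) = 0 := fun z => (hπ _).2 (dvd_mul_right _ _)
  set a : Fin 3 → ℕ := ![D.a 0, D.a 1, D.a 2] with ha
  set y : Fin 3 → ℤ_[p] := ![D.y 0, D.y 1, D.y 2] with hy
  have haj : ∀ j, a j ≤ D.a 2 := fun j => by fin_cases j <;> simp [ha] <;> omega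
  have h2π : 2 * π t = 1 := by rw [← map_ofNat π 2, ← map_mul, ht, map_one]
  set κ : ℤ_[p] := (-1) ^ (D.a 0 + D.a 1 + D.a 2) *
    (∏ i ∈ Finset.range (D.a 1), ((i : ℤ_[p]) + 1 - p * D.y 1)) *
    ∏ i ∈ Finset.range (D.a 2), ((i : ℤ_[p]) + 1 - p * D.y 2)
  set N : (ℤ_[p] ⧸ I)[X] := C (π κ) *
    ∏ i ∈ Finset.range (D.a 0), (X - C (π (p * D.y 0 - (i + 1)))) with hN
  have he : (0 : Fin 3 → ℤ_[p] ⧸ I) = fun j => π (p * y j) := funext fun j => (hε _).symm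
  have key := sum_jet_three_eq (h := π t) (a := a) (N := N) (P := X ^ n)
    (u := fun k => π (D.A k)) (l := fun k => π (D.logDeriv₁ k)) (m := fun k => π (D.logDeriv₂ k))
    (q₀ := fun k => π (q₀ k)) (q₁ := fun k => π (q₁ k)) (q₂ := fun k => π (q₂ k))
    h5 h1 (fun k hk l hl hkl => ?_) ?_ (fun k => ?_) (fun k hk => ?_)
  · rw [← hπ, map_sum, ← key]
    refine Finset.sum_congr rfl fun k hk => ?_
    have hJ2 : π (J₂ k) = π t * (π (D.logDeriv₁ k) ^ 2 + π (D.logDeriv₂ k)) := by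
      rw [← map_pow, ← map_add, ← map_mul, ← hJ]
      congr 1
      linear_combination (-J₂ k) * ht
    rw [← hJ2]
    simp only [show a 0 = D.a 0 from rfl, show a 1 = D.a 1 from rfl]
    split_ifs <;> simp only [map_add, map_mul]
  · have hl : l ≤ D.a 2 := hl
    have hk : k ≤ D.a 2 := hk
    have := (isUnit_sub_add (i := l) (k := k) (by omega) (by omega) hkl.symm (0 : ℤ_[p])).map π
    simpa using this
  · have hd : N.natDegree ≤ D.a 0 := by
      refine (natDegree_C_mul_le _ _).trans ?_
      rw [natDegree_prod_of_monic _ _ fun i _ => monic_X_sub_C _]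
      simp only [natDegree_X_sub_C]
      simp
    refine natDegree_mul_le.trans_lt ?_
    rw [natDegree_X_pow]
    have : a 0 = D.a 0 ∧ a 1 = D.a 1 ∧ a 2 = D.a 2 := ⟨rfl, rfl, rfl⟩
    -- As a 1 + a 2 = p - 1 ≥ 1, the degree n + a 0 with n ≤ 2 stays below the bound.
    have := hp.two_le
    omega
  · have := hq (ℤ_[p] ⧸ I)[X] (C.comp π) k (X - C (k : ℤ_[p] ⧸ I))
    simpa using this
  · have hk : k ≤ D.a 2 := hk
    have hkp : k < p := by omega
    have hC : IsJet (π t) (X - C (k : ℤ_[p] ⧸ I)) (C (π κ)) (π κ) 0 0 := by simp [IsJet, jet]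
    rw [he]
    refine IsJet.dvd_mul_jet_sub h2π (isJet_coNodeFactor π h2π y
      (fun j => (haj j).trans_lt (by omega)) hkp) (hC.mul h2π (isJet_prod_add π h2π (D.y 0)
      (by omega))) ?_ ?_ ?_
    · have hu : IsUnit (π (k.factorial ^ 4)) := ((isUnit_factorial hkp).pow 4).map π
      have hA := congrArg π (D.A_mul_prod_three hk)
      refine hu.mul_left_cancel ?_
      have hsq : π (∏ i ∈ Finset.range k, (((i : ℤ_[p]) + 1) ^ 2 - (p * D.y 0) ^ 2)) =
          π k.factorial ^ 2 := by
        rw [← map_pow, ← Finset.prod_range_add_one_eq_factorial]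
        push_cast
        rw [← Finset.prod_pow, map_prod, map_prod]
        refine Finset.prod_congr rfl fun i _ => ?_
        rw [map_sub, map_pow π (p * D.y 0), hε, zero_pow two_ne_zero, sub_zero]
      rw [map_mul π _ (_ * _ * _), map_mul π (_ * _) (∏ i ∈ Finset.range k, _),
        map_mul π (∏ i ∈ Finset.range k, _) (∏ i ∈ Finset.range k, _), hsq,
        map_prod_range_eq_factorial π hε, map_prod_range_eq_factorial π hε,
        map_mul π κ, map_mul π _ (D.A k * _), map_mul π (D.A k)] at hA
      rw [map_pow] at hA ⊢
      linear_combination hA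
    · rw [zero_add, ← map_add, ← sub_eq_zero, ← map_sub, hπ]
      have hG : ∀ y, (p : ℤ_[p]) ∣ D.G (p * y) - D.G 0 := fun y =>
        (dvd_pow_self _ two_ne_zero).trans (D.G_dvd y)
      have f := fun (j : Fin 3) => dvd_telescope_sub D.G_add_one inv_mul_eq_zero
        dvd_inv_add_sub_inv hG (y j) (a j) k
      have f3 := dvd_telescope_add D.G_add_one inv_mul_eq_zero dvd_inv_add_sub_inv hG (D.y 0)
        (D.a 0) k
      convert dvd_add (dvd_add (dvd_add (f 0) (f 1)) (f 2)) f3 using 1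
      simp only [logDeriv₁, Fin.sum_univ_three, Fin.sum_univ_four, x_three_add]
      simp only [D.x_eq, show a 0 = D.a 0 from rfl, show a 1 = D.a 1 from rfl,
        show a 2 = D.a 2 from rfl, show y 0 = D.y 0 from rfl, show y 1 = D.y 1 from rfl,
        show y 2 = D.y 2 from rfl]
      ring
    · rw [zero_add, ← map_add, ← sub_eq_zero, ← map_sub, hπ]
      have hH : ∀ y, (p : ℤ_[p]) ∣ D.H (p * y) - D.H 0 := fun y =>
        dvd_sub (D.H_dvd y) (by simpa using D.H_dvd 0)
      have hH1 : ∀ x, D.H (x + 1) = D.H x + -x.inv ^ 2 := fun x => by rw [D.H_add_one]; ring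
      have hH0 : ∀ y : ℤ_[p], -(p * y : ℤ_[p]).inv ^ 2 = 0 := fun y => by
        rw [inv_mul_eq_zero]; ring
      have f := fun (j : Fin 3) => dvd_telescope_sub hH1 hH0 dvd_neg_inv_sq_sub hH (y j) (a j) k
      have f3 := dvd_telescope_add hH1 hH0 dvd_neg_inv_sq_sub hH (D.y 0) (D.a 0) k
      convert dvd_add (dvd_add (dvd_add (f 0) (f 1)) (f 2)) f3 using 1
      simp only [logDeriv₂, Fin.sum_univ_three, Fin.sum_univ_four, x_three_add]
      simp only [D.x_eq, show a 0 = D.a 0 from rfl, show a 1 = D.a 1 from rfl,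
        show a 2 = D.a 2 from rfl, show y 0 = D.y 0 from rfl, show y 1 = D.y 1 from rfl,
        show y 2 = D.y 2 from rfl]
      ring

lemma sum_range_ite₃ {M : Type*} [AddCommMonoid M] (f g h : ℕ → M) {a b c : ℕ} (hab : a ≤ b)
    (hbc : b ≤ c) : ∑ k ∈ Finset.range (c + 1), (if k ≤ a then f k else if k ≤ b then g k else h k) =
      ∑ k ∈ Finset.Icc 0 a, f k + ∑ k ∈ Finset.Icc (a + 1) b, g k +
        ∑ k ∈ Finset.Icc (b + 1) c, h k := by
  have e1 : (Finset.range (c + 1)).filter (· ≤ a) = Finset.Icc 0 a := by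
    ext; simp only [Finset.mem_filter, Finset.mem_range, Finset.mem_Icc]; omega
  have e2 : ((Finset.range (c + 1)).filter (¬ · ≤ a)).filter (· ≤ b) = Finset.Icc (a + 1) b := by
    ext; simp only [Finset.mem_filter, Finset.mem_range, Finset.mem_Icc]; omega
  have e3 : ((Finset.range (c + 1)).filter (¬ · ≤ a)).filter (¬ · ≤ b) = Finset.Icc (b + 1) c := by
    ext; simp only [Finset.mem_filter, Finset.mem_range, Finset.mem_Icc]; omega
  rw [Finset.sum_ite, Finset.sum_ite, e1, e2, e3, add_assoc]

lemma sum_range_ite₂ {M : Type*} [AddCommMonoid M] (f g : ℕ → M) {a b : ℕ} (hab : a ≤ b) :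
    ∑ k ∈ Finset.range (b + 1), (if k ≤ a then f k else g k) =
      ∑ k ∈ Finset.Icc 0 a, f k + ∑ k ∈ Finset.Icc (a + 1) b, g k := by
  have e1 : (Finset.range (b + 1)).filter (· ≤ a) = Finset.Icc 0 a := by
    ext; simp only [Finset.mem_filter, Finset.mem_range, Finset.mem_Icc]; omega
  have e2 : (Finset.range (b + 1)).filter (¬ · ≤ a) = Finset.Icc (a + 1) b := by
    ext; simp only [Finset.mem_filter, Finset.mem_range, Finset.mem_Icc]; omega
  rw [Finset.sum_ite, e1, e2]

/-- The sum `C̃₁ / p`. -/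
noncomputable def companion₁ : ℤ_[p] :=
  ∑ k ∈ Finset.Icc 0 (D.a 0), D.A k * (D.logDeriv₁ k * k + 1) +
    ∑ k ∈ Finset.Icc (D.a 0 + 1) (D.a 1),
      (p * D.y 0 * (D.A k * (D.logDeriv₁ k * k + 1)) + D.A k * k) +
    ∑ k ∈ Finset.Icc (D.a 1 + 1) (D.a 2), p * (D.y 0 + D.y 1) * (D.A k * k)

/-- The sum `C̃₂ / p²`. -/
noncomputable def companion₂ (J₂ : ℕ → ℤ_[p]) : ℤ_[p] :=
  ∑ k ∈ Finset.Icc 0 (D.a 0), D.A k * (J₂ k * k ^ 2 + D.logDeriv₁ k * k) +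
    ∑ k ∈ Finset.Icc (D.a 0 + 1) (D.a 1), D.A k * (D.logDeriv₁ k * k + 1) * k +
    ∑ k ∈ Finset.Icc (D.a 1 + 1) (D.a 2), D.A k * k ^ 2

/-- Adding p(y 0 + y 1) times the modulo-p residue sum for X cancels the correction terms of the
modulo-p² sum, including all of J₂, and supplies the block above a 1. The added quantity is
divisible by p². -/
theorem sq_dvd_companion₁_sub_sign {J₂ : ℕ → ℤ_[p]}
    (hJ : ∀ k, 2 * J₂ k = D.logDeriv₁ k ^ 2 + D.logDeriv₂ k) :
    (p : ℤ_[p]) ^ 2 ∣ D.companion₁ - D.sign := by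
  have h2 := D.sq_dvd_sum_sub_sign hJ
  obtain ⟨w, h3⟩ := D.dvd_sum_jet hJ one_le_two (q₀ := fun k => k) (q₁ := fun _ => 1)
    (q₂ := fun _ => 0) (fun S _ π k x => by simp; ring)
  rw [sum_range_ite₂ _ _ D.a_le₀] at h2
  rw [sum_range_ite₃ _ _ _ D.a_le₀ D.a_le₁] at h3
  have h4 : (p : ℤ_[p]) ^ 2 ∣ p * (D.y 0 + D.y 1) * (p * w) := ⟨(D.y 0 + D.y 1) * w, by ring⟩
  have h5 := dvd_add h2 h4
  rw [← h3] at h5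
  convert h5 using 1
  rw [companion₁, sub_add_eq_add_sub]
  congr 1
  rw [mul_add (p * (D.y 0 + D.y 1) : ℤ_[p]), mul_add (p * (D.y 0 + D.y 1) : ℤ_[p]),
    Finset.mul_sum, Finset.mul_sum, Finset.mul_sum]
  have r : ∀ a b c d e : ℤ_[p], a + b + (c + d + e) = (a + c) + (b + d) + e := fun a b c d e => by
    ring
  rw [r, ← Finset.sum_add_distrib, ← Finset.sum_add_distrib]
  refine congrArg₂ (· + ·) (congrArg₂ (· + ·) ?_ ?_) ?_ <;>
    refine Finset.sum_congr rfl fun k _ => ?_ <;> ring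

/-- Termwise modulo p, `companion₂` is the residue sum for X² minus `companion₁`: for k ≤ a 0 the
expansion k²J₂ + 2kJ₁ + 1 loses kJ₁ + 1. -/
theorem dvd_companion₂_add_sign {J₂ : ℕ → ℤ_[p]}
    (hJ : ∀ k, 2 * J₂ k = D.logDeriv₁ k ^ 2 + D.logDeriv₂ k) :
    (p : ℤ_[p]) ∣ D.companion₂ J₂ + D.sign := by
  have h1 := (dvd_pow_self _ two_ne_zero).trans (D.sq_dvd_companion₁_sub_sign hJ)
  have h2 := D.dvd_sum_jet hJ le_rfl (q₀ := fun k => k ^ 2) (q₁ := fun k => 2 * k)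
    (q₂ := fun _ => 1) (fun S _ π k x => by
      simp only [map_mul, map_pow, map_natCast, map_ofNat, map_one]; ring)
  rw [sum_range_ite₃ _ _ _ D.a_le₀ D.a_le₁] at h2
  have h3 : (p : ℤ_[p]) ∣ (∑ k ∈ Finset.Icc (D.a 0 + 1) (D.a 1),
      p * (D.y 0 * (D.A k * (D.logDeriv₁ k * k + 1)))) +
      ∑ k ∈ Finset.Icc (D.a 1 + 1) (D.a 2), p * ((D.y 0 + D.y 1) * (D.A k * k)) := by
    exact dvd_add (Finset.dvd_sum fun _ _ => dvd_mul_right _ _)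
      (Finset.dvd_sum fun _ _ => dvd_mul_right _ _)
  convert dvd_add (dvd_sub h2 h1) h3 using 1
  have r : ∀ a₀ a₁ a₂ b₀ b₁ b₂ c₀ c₁ c₂ d₁ d₂ s : ℤ_[p], a₀ + b₀ = c₀ → a₁ + b₁ = c₁ + d₁ →
      a₂ + b₂ = c₂ + d₂ →
      a₀ + a₁ + a₂ + s = c₀ + c₁ + c₂ - (b₀ + b₁ + b₂ - s) + (d₁ + d₂) := by
    intro a₀ a₁ a₂ b₀ b₁ b₂ c₀ c₁ c₂ d₁ d₂ s h₀ h₁ h₂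
    linear_combination h₀ + h₁ + h₂
  rw [companion₁, companion₂]
  refine r _ _ _ _ _ _ _ _ _ _ _ _ ?_ ?_ ?_
  · rw [← Finset.sum_add_distrib]
    exact Finset.sum_congr rfl fun k _ => by ring
  · rw [← Finset.sum_add_distrib, ← Finset.sum_add_distrib]
    exact Finset.sum_congr rfl fun k _ => by ring
  · rw [← Finset.sum_add_distrib, ← Finset.sum_add_distrib]
    exact Finset.sum_congr rfl fun k _ => by ring

end PairedData

end Companion

/-! ### Arithmetic of the dash operation and the symmetric labelling. -/

namespace Companion

/-- The common denominator 120 = 2³ · 3 · 5 is prime to every p > 5, which is how p-integrality is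
obtained. -/
lemma IsCYMultiset.mem_bounds {α : Multiset ℚ} (hα : IsCYMultiset α) {r : ℚ} (hr : r ∈ α) :
    0 < r ∧ r < 1 ∧ ∃ n : ℤ, 120 * r = n := by
  have key : ∀ s : ℚ, s ∈ ({1 / 2, 1 / 3, 1 / 4, 1 / 6, 1 / 5, 2 / 5, 1 / 8, 3 / 8, 1 / 10, 3 / 10,
      1 / 12, 5 / 12} : Set ℚ) → 0 < s ∧ s < 1 ∧ ∃ n : ℤ, 120 * s = n := by
    intro s hs
    simp only [Set.mem_insert_iff, Set.mem_singleton_iff] at hs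
    rcases hs with h | h | h | h | h | h | h | h | h | h | h | h <;> subst h <;>
      refine ⟨by norm_num, by norm_num, ?_⟩
    exacts [⟨60, by norm_num⟩, ⟨40, by norm_num⟩, ⟨30, by norm_num⟩, ⟨20, by norm_num⟩,
      ⟨24, by norm_num⟩, ⟨48, by norm_num⟩, ⟨15, by norm_num⟩, ⟨45, by norm_num⟩,
      ⟨12, by norm_num⟩, ⟨36, by norm_num⟩, ⟨10, by norm_num⟩, ⟨50, by norm_num⟩]
  have key' : ∀ s : ℚ, (0 < s ∧ s < 1 ∧ ∃ n : ℤ, 120 * s = n) →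
      0 < 1 - s ∧ 1 - s < 1 ∧ ∃ n : ℤ, 120 * (1 - s) = n := by
    rintro s ⟨h0, h1, n, hn⟩
    exact ⟨by linarith, by linarith, 120 - n, by push_cast; linarith⟩
  obtain ⟨s, t, hst, rfl⟩ := hα
  have hs : (0 < s ∧ s < 1 ∧ ∃ n : ℤ, 120 * s = n) ∧ (0 < t ∧ t < 1 ∧ ∃ n : ℤ, 120 * t = n) := by
    constructor <;> apply key <;>
      simp only [Set.mem_insert_iff, Set.mem_singleton_iff, Prod.mk.injEq] at hst ⊢ <;> tauto
  simp only [Multiset.insert_eq_cons, Multiset.mem_cons, Multiset.mem_singleton] at hr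
  rcases hr with rfl | rfl | rfl | rfl
  exacts [hs.1, key' _ hs.1, hs.2, key' _ hs.2]

lemma IsCYMultiset.map_one_sub {α : Multiset ℚ} (hα : IsCYMultiset α) :
    α.map (fun r => 1 - r) = α := by
  obtain ⟨s, t, -, rfl⟩ := hα
  simp only [Multiset.insert_eq_cons, Multiset.map_cons, Multiset.map_singleton, sub_sub_cancel]
  simp only [← Multiset.singleton_add]
  abel

variable {p : ℕ} [Fact p.Prime]

lemma negDigit_lt (r : ℚ) : negDigit p r < p := by
  have := (Fact.out : p.Prime).pos
  have : NeZero p := ⟨this.ne'⟩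
  rw [negDigit, firstDigit]
  split_ifs
  · exact ZMod.val_lt _
  · assumption

lemma negDigit_eq_val {x : ℤ_[p]} {r : ℚ} (hx : (x : ℚ_[p]) = r) :
    negDigit p r = (PadicInt.toZMod (-x)).val := by
  have h : ‖-(r : ℚ_[p])‖ ≤ 1 := by rw [← hx, norm_neg]; exact x.2
  rw [negDigit, firstDigit, dif_pos h]
  congr 2
  exact Subtype.ext (by simp [hx])

lemma exists_dash {x : ℤ_[p]} {r : ℚ} (hx : (x : ℚ_[p]) = r) :
    ∃ y : ℤ_[p], (y : ℚ_[p]) = dash p r ∧ x = -negDigit p r + p * y := by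
  have hp := (Fact.out : p.Prime)
  have : NeZero p := ⟨hp.ne_zero⟩
  have h : x + negDigit p r ∈ IsLocalRing.maximalIdeal ℤ_[p] := by
    rw [← PadicInt.ker_toZMod, RingHom.mem_ker, map_add, map_natCast, negDigit_eq_val hx,
      ZMod.natCast_val, ZMod.cast_id, map_neg, add_neg_cancel]
  rw [PadicInt.maximalIdeal_eq_span_p, Ideal.mem_span_singleton] at h
  obtain ⟨y, hy⟩ := h
  refine ⟨y, ?_, by rw [← hy]; ring⟩
  have hp0 : (p : ℚ_[p]) ≠ 0 := by exact_mod_cast hp.ne_zero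
  rw [dash]
  push_cast
  rw [eq_div_iff hp0, ← hx]
  have := congrArg (fun z : ℤ_[p] => (z : ℚ_[p])) hy
  push_cast at this
  rw [this, mul_comm]

lemma negDigit_eq {x y : ℤ_[p]} {r : ℚ} (hx : (x : ℚ_[p]) = r) {a : ℕ} (ha : a < p)
    (h : x = -a + p * y) : negDigit p r = a := by
  rw [negDigit_eq_val hx, h]
  simp [ZMod.val_natCast, Nat.mod_eq_of_lt ha]

lemma eq_neg_negDigit_add (r : ℚ) : r = -negDigit p r + p * dash p r := by
  have : (p : ℚ) ≠ 0 := by exact_mod_cast (Fact.out : p.Prime).ne_zero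
  rw [dash]
  field_simp
  ring

lemma dash_pos {r : ℚ} (hr : 0 < r) : 0 < dash p r := by
  have : (0 : ℚ) < p := by exact_mod_cast (Fact.out : p.Prime).pos
  rw [dash]
  positivity

lemma negDigit_one_sub_add {x : ℤ_[p]} {r : ℚ} (hx : (x : ℚ_[p]) = r) :
    negDigit p r + negDigit p (1 - r) + 1 = p := by
  obtain ⟨y, -, h⟩ := exists_dash hx
  have hlt := negDigit_lt (p := p) r
  have hx' : ((1 - x : ℤ_[p]) : ℚ_[p]) = ((1 - r : ℚ) : ℚ_[p]) := by push_cast; rw [hx]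
  have : negDigit p (1 - r) = p - 1 - negDigit p r := by
    refine negDigit_eq (y := 1 - y) hx' (by omega) ?_
    rw [h, Nat.cast_sub (by omega), Nat.cast_sub (by omega)]
    push_cast
    ring
  omega

lemma dash_one_sub {x : ℤ_[p]} {r : ℚ} (hx : (x : ℚ_[p]) = r) :
    dash p (1 - r) = 1 - dash p r := by
  have h : (negDigit p r : ℚ) + negDigit p (1 - r) + 1 = p := by
    exact_mod_cast negDigit_one_sub_add hx
  have h0 : (p : ℚ) ≠ 0 := by exact_mod_cast (Fact.out : p.Prime).ne_zero
  rw [dash, dash]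
  field_simp
  linarith

/-- Equal dashes make r - s a difference of digits, hence an integer, and it lies strictly between
-1 and 1. -/
lemma dash_injOn : Set.InjOn (dash p) (Set.Ioo 0 1) := by
  intro r hr s hs h
  have h1 := eq_neg_negDigit_add (p := p) r
  have h2 := eq_neg_negDigit_add (p := p) s
  rw [h] at h1
  have h3 : r - s = ((negDigit p s - negDigit p r : ℤ) : ℚ) := by push_cast; linarith
  have h4 : ((negDigit p s - negDigit p r : ℤ) : ℚ) < 1 := by linarith [hr.2, hs.1]
  have h5 : (-1 : ℚ) < ((negDigit p s - negDigit p r : ℤ) : ℚ) := by linarith [hr.1, hs.2]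
  have h6 : (negDigit p s - negDigit p r : ℤ) = 0 := by
    have h4' : (negDigit p s - negDigit p r : ℤ) < 1 := by exact_mod_cast h4
    have h5' : (-1 : ℤ) < (negDigit p s - negDigit p r : ℤ) := by exact_mod_cast h5
    omega
  rw [h6, Int.cast_zero] at h3
  linarith

lemma negDigit_le_of_dash_le {r s : ℚ} (hr : r ∈ Set.Ioo (0 : ℚ) 1) (hs : s ∈ Set.Ioo (0 : ℚ) 1)
    (h : dash p r ≤ dash p s) : negDigit p r ≤ negDigit p s := by
  have h1 := eq_neg_negDigit_add (p := p) r
  have h2 := eq_neg_negDigit_add (p := p) s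
  have h3 := mul_le_mul_of_nonneg_left h (Nat.cast_nonneg (α := ℚ) p)
  have h4 : (negDigit p r : ℚ) < negDigit p s + 1 := by linarith [hr.1, hs.2]
  have h5 : negDigit p r < negDigit p s + 1 := by exact_mod_cast h4
  omega

/-- Two monotone tuples with the same multi-set of values are equal. -/
lemma eq_of_map_univ_eq {n : ℕ} {f g : Fin n → ℚ} (hf : Monotone f) (hg : Monotone g)
    (h : Finset.univ.val.map f = Finset.univ.val.map g) : f = g := by
  refine List.ofFn_injective (List.Perm.eq_of_sortedLE hf.sortedLE_ofFn hg.sortedLE_ofFn ?_)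
  rw [← Multiset.coe_eq_coe]
  simpa [Fin.univ_def, List.ofFn_eq_map] using h

/-- The map r ↦ 1 - r preserves α and turns r' into 1 - r', so reversing the labelling and
reflecting gives another sorted list of the same dashes. Sorted lists agree, and the dash is
injective on (0, 1). -/
lemma IsOrderedLabelling.rev_eq {α : Multiset ℚ} {r : Fin 4 → ℚ} (hr : IsOrderedLabelling p α r)
    (hα : IsCYMultiset α) {x : Fin 4 → ℤ_[p]} (hx : ∀ j, (x j : ℚ_[p]) = r j) (j : Fin 4) :
    r j.rev = 1 - r j := by
  have hmem : ∀ j, r j ∈ Set.Ioo (0 : ℚ) 1 := fun j => by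
    obtain ⟨h0, h1, -⟩ := hα.mem_bounds (r := r j) (by
      rw [← hr.1]; exact Multiset.mem_map_of_mem _ (Finset.mem_univ_val j))
    exact ⟨h0, h1⟩
  have hmono : Monotone fun j => dash p (1 - r (Fin.rev j)) := by
    intro i j hij
    simp only [dash_one_sub (hx _)]
    have := hr.2 (Fin.rev_le_rev.2 hij)
    simp only at this
    linarith
  have hmap : Finset.univ.val.map (fun j => dash p (r j)) =
      Finset.univ.val.map (fun j => dash p (1 - r (Fin.rev j))) := by
    have hrev : Finset.univ.val.map (Fin.rev : Fin 4 → Fin 4) = Finset.univ.val := by decide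
    calc Finset.univ.val.map (fun j => dash p (r j)) = α.map (dash p) := by
          rw [← hr.1, Multiset.map_map]; rfl
      _ = Finset.univ.val.map (fun j => dash p (1 - r j)) := by
          rw [← hα.map_one_sub, ← hr.1, Multiset.map_map, Multiset.map_map]; rfl
      _ = (Finset.univ.val.map Fin.rev).map (fun j => dash p (1 - r j)) := by rw [hrev]
      _ = _ := Multiset.map_map _ _ _
  have h := congrFun (eq_of_map_univ_eq hr.2 hmono hmap) j
  have hm := hmem (Fin.rev j)
  have := dash_injOn (hmem j) ⟨by linarith [hm.2], by linarith [hm.1]⟩ h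
  linarith

lemma norm_ratCast_le_one_of_mul_eq (hp : 5 < p) {r : ℚ} {n : ℤ} (h : 120 * r = n) :
    ‖(r : ℚ_[p])‖ ≤ 1 := by
  have h120 : ‖((120 : ℕ) : ℚ_[p])‖ = 1 := by
    have hpr := (Fact.out : p.Prime)
    rw [Padic.norm_natCast_eq_one_iff, hpr.coprime_iff_not_dvd]
    intro hd
    have : (120 : ℕ) = 2 ^ 3 * (3 * 5) := by norm_num
    rw [this, hpr.dvd_mul, hpr.dvd_mul] at hd
    rcases hd with hd | hd | hd
    · have := Nat.le_of_dvd (by norm_num) (hpr.dvd_of_dvd_pow hd); omega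
    · have := Nat.le_of_dvd (by norm_num) hd; omega
    · have := Nat.le_of_dvd (by norm_num) hd; omega
  have h' : ((120 : ℕ) : ℚ_[p]) * (r : ℚ_[p]) = (n : ℚ_[p]) := by exact_mod_cast h
  calc ‖(r : ℚ_[p])‖ = ‖((120 : ℕ) : ℚ_[p]) * (r : ℚ_[p])‖ := by rw [norm_mul, h120, one_mul]
    _ ≤ 1 := by rw [h']; exact Padic.norm_int_le_one n

lemma seven_le (hp : 5 < p) : 7 ≤ p := by
  have h6 : p ≠ 6 := by
    rintro rfl
    exact absurd (Fact.out : (6 : ℕ).Prime) (by norm_num)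
  omega

/-- The `p`-adic data attached to an ordered labelling. -/
lemma exists_pairedData (hp : 5 < p) {α : Multiset ℚ} (hα : IsCYMultiset α) {r : Fin 4 → ℚ}
    (hr : IsOrderedLabelling p α r) :
    ∃ D : PairedData p, D.a = (fun j => negDigit p (r j)) ∧ (∀ j, (D.x j : ℚ_[p]) = r j) ∧
      (∀ j, (D.y j : ℚ_[p]) = dash p (r j)) ∧ (∀ x : ℤ_[p], G₁ p x = D.G x) ∧
      (∀ x : ℤ_[p], G₂ p x = D.H x + (D.G x : ℚ_[p]) ^ 2) ∧ ∀ j, (D.y j : ℚ_[p]) ≠ 0 := by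
  have hb : ∀ j, 0 < r j ∧ r j < 1 ∧ ∃ n : ℤ, 120 * r j = n := fun j => hα.mem_bounds (by
    rw [← hr.1]; exact Multiset.mem_map_of_mem _ (Finset.mem_univ_val j))
  have hn : ∀ j, ‖(r j : ℚ_[p])‖ ≤ 1 := fun j => by
    obtain ⟨-, -, n, hn⟩ := hb j
    exact norm_ratCast_le_one_of_mul_eq hp hn
  let x : Fin 4 → ℤ_[p] := fun j => ⟨r j, hn j⟩
  have hx : ∀ j, (x j : ℚ_[p]) = r j := fun j => rfl
  choose y hy hxy using fun j => exists_dash (hx j)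
  have hrev := hr.rev_eq hα hx
  have hIoo : ∀ j, r j ∈ Set.Ioo (0 : ℚ) 1 := fun j => ⟨(hb j).1, (hb j).2.1⟩
  have hle : ∀ {i j}, i ≤ j → negDigit p (r i) ≤ negDigit p (r j) := fun h =>
    negDigit_le_of_dash_le (hIoo _) (hIoo _) (hr.2 h)
  have h3 : r 3 = 1 - r 0 := hrev 0
  have h2 : r 2 = 1 - r 1 := hrev 1
  obtain ⟨G, H, hG₁, hG₂, hG, hH, hGd, hHd⟩ := exists_logDeriv (p := p) (seven_le hp)
  refine ⟨{
    a := fun j => negDigit p (r j)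
    x := x
    y := y
    A := fun k => (∏ j, ∏ i ∈ (Finset.range k).erase (negDigit p (r j)), (x j + i)) *
      ((k.factorial : ℤ_[p]) ^ 4).inv
    G := G
    H := H
    ne_two := by omega
    x_eq := hxy
    x_two := Subtype.ext (by push_cast; rw [hx, hx, h2]; push_cast; rfl)
    x_three := Subtype.ext (by push_cast; rw [hx, hx, h3]; push_cast; rfl)
    a_le₀ := hle (by decide)
    a_le₁ := hle (by decide)
    a_le₂ := hle (by decide)
    a_add₀ := by simp only [h3]; exact negDigit_one_sub_add (hx 0)
    a_add₁ := by simp only [h2]; exact negDigit_one_sub_add (hx 1)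
    A_spec := fun k hk => by
      rw [mul_left_comm, mul_inv_of_isUnit ((PairedData.isUnit_factorial hk).pow 4), mul_one]
    G_add_one := hG
    H_add_one := hH
    G_dvd := hGd
    H_dvd := hHd }, rfl, hx, hy, hG₁, hG₂, fun j => ?_⟩
  change (y j : ℚ_[p]) ≠ 0
  rw [hy]
  exact_mod_cast (dash_pos (hb j).1).ne'

lemma sum_Icc_add_sum_Icc {M : Type*} [AddCommMonoid M] (f : ℕ → M) {m a b : ℕ} (hm : m ≤ a + 1)
    (hab : a ≤ b) : ∑ k ∈ Finset.Icc m a, f k + ∑ k ∈ Finset.Icc (a + 1) b, f k =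
      ∑ k ∈ Finset.Icc m b, f k := by
  rw [← Finset.sum_filter_add_sum_filter_not (Finset.Icc m b) (· ≤ a)]
  congr 2 <;> ext <;> simp only [Finset.mem_filter, Finset.mem_Icc] <;> omega

lemma padicInt_coe_prod {ι : Type*} (s : Finset ι) (f : ι → ℤ_[p]) :
    ((∏ i ∈ s, f i : ℤ_[p]) : ℚ_[p]) = ∏ i ∈ s, (f i : ℚ_[p]) :=
  map_prod PadicInt.Coe.ringHom f s

/-! ### Translation of the sums in ℚ_p into the integral data. -/

namespace PairedData

variable (D : PairedData p)

/-- In the Pochhammer product of x_j the factor with i = a_j is p y_j. For k ≤ a 2 it can occur only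
for j = 0 and j = 1. -/
lemma factorial_pow_mul_ite {k : ℕ} (hk : k ≤ D.a 2) :
    (k.factorial : ℤ_[p]) ^ 4 * (D.A k * (if D.a 0 < k then p * D.y 0 else 1) *
      (if D.a 1 < k then p * D.y 1 else 1)) = ∏ j, ∏ i ∈ Finset.range k, (D.x j + i) := by
  have h := D.a_add₀
  have h' := D.a_le₂
  have key : ∀ j, ∏ i ∈ Finset.range k, (D.x j + i) =
      (if D.a j < k then p * D.y j else 1) *
        ∏ i ∈ (Finset.range k).erase (D.a j), (D.x j + i) := fun j => by
    split_ifs with hj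
    · rw [← Finset.mul_prod_erase _ _ (Finset.mem_range.2 hj)]
      congr 1
      rw [D.x_eq]
      ring
    · rw [Finset.erase_eq_of_notMem (by simpa using hj), one_mul]
  rw [← mul_assoc, ← mul_assoc, D.A_spec k (by omega)]
  simp only [key, Finset.prod_mul_distrib]
  rw [Fin.prod_univ_four (fun j => if D.a j < k then (p : ℤ_[p]) * D.y j else 1),
    if_neg (by omega : ¬ D.a 2 < k), if_neg (by omega : ¬ D.a 3 < k)]
  ring

variable {D} {r : Fin 4 → ℚ}

lemma pochQuot_eq (hx : ∀ j, (D.x j : ℚ_[p]) = r j) {k : ℕ} (hk : k ≤ D.a 2) :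
    (pochQuot r k : ℚ_[p]) = ((D.A k * (if D.a 0 < k then p * D.y 0 else 1) *
      (if D.a 1 < k then p * D.y 1 else 1) : ℤ_[p]) : ℚ_[p]) := by
  have h := congrArg (fun z : ℤ_[p] => (z : ℚ_[p])) (D.factorial_pow_mul_ite hk)
  have hk0 : (k.factorial : ℚ_[p]) ^ 4 ≠ 0 :=
    pow_ne_zero _ (by exact_mod_cast k.factorial_ne_zero)
  rw [pochQuot, Rat.cast_div, Rat.cast_pow, Rat.cast_natCast, div_eq_iff hk0, mul_comm]
  simp only [PadicInt.coe_mul, PadicInt.coe_pow, PadicInt.coe_natCast] at h ⊢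
  have hprod : ∀ (k : ℕ) (q : ℚ), (ascPochhammer ℚ k).eval q = ∏ i ∈ Finset.range k, (q + i) :=
    fun k q => by
      induction k with
      | zero => simp
      | succ k ih => rw [ascPochhammer_succ_eval, Finset.prod_range_succ, ih]
  rw [h]
  simp only [padicInt_coe_prod, PadicInt.coe_add, PadicInt.coe_natCast, hx,
    hprod, Rat.cast_prod, Rat.cast_add, Rat.cast_natCast]

lemma J₁_eq (hx : ∀ j, (D.x j : ℚ_[p]) = r j) (hG : ∀ x : ℤ_[p], G₁ p x = D.G x) (k : ℕ) :
    J₁ p r k = D.logDeriv₁ k := by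
  simp only [J₁, logDeriv₁, PadicInt.coe_sum, PadicInt.coe_sub, ← hG, PadicInt.coe_add,
    PadicInt.coe_natCast, PadicInt.coe_one, hx]

/-- With G₂ = H + G₁², the combination defining J₂ is half the square of J₁ plus half its
derivative, i.e. the second Taylor coefficient of a function with logarithmic derivative J₁. -/
lemma two_mul_J₂_eq (hx : ∀ j, (D.x j : ℚ_[p]) = r j) (hG : ∀ x : ℤ_[p], G₁ p x = D.G x)
    (hH : ∀ x : ℤ_[p], G₂ p x = D.H x + (D.G x : ℚ_[p]) ^ 2) (k : ℕ) :
    2 * J₂ p r k = ((D.logDeriv₁ k ^ 2 + D.logDeriv₂ k : ℤ_[p]) : ℚ_[p]) := by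
  have h1 : ∀ j, ((r j : ℚ_[p]) + k) = ((D.x j + k : ℤ_[p]) : ℚ_[p]) := fun j => by
    push_cast; rw [hx]
  have h2 : (1 + k : ℚ_[p]) = ((1 + k : ℤ_[p]) : ℚ_[p]) := by push_cast; rfl
  have e0 : Finset.Ioi (0 : Fin 4) = {1, 2, 3} := by decide
  have e1 : Finset.Ioi (1 : Fin 4) = {2, 3} := by decide
  have e2 : Finset.Ioi (2 : Fin 4) = {3} := by decide
  have e3 : Finset.Ioi (3 : Fin 4) = ∅ := by decide
  simp only [J₂, logDeriv₁, logDeriv₂, h1, h2, hG, hH, Fin.sum_univ_four, e0, e1, e2, e3]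
  rw [Finset.sum_insert (by decide), Finset.sum_insert (by decide), Finset.sum_insert (by decide)]
  simp only [Finset.sum_singleton, Finset.sum_empty]
  simp only [PadicInt.coe_add, PadicInt.coe_sub, PadicInt.coe_pow]
  ring

lemma exists_J₂_eq (D : PairedData p) (hx : ∀ j, (D.x j : ℚ_[p]) = r j)
    (hG : ∀ x : ℤ_[p], G₁ p x = D.G x) (hH : ∀ x : ℤ_[p], G₂ p x = D.H x + (D.G x : ℚ_[p]) ^ 2) :
    ∃ J : ℕ → ℤ_[p], (∀ k, 2 * J k = D.logDeriv₁ k ^ 2 + D.logDeriv₂ k) ∧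
      ∀ k, J₂ p r k = J k := by
  obtain ⟨t, ht⟩ := D.exists_half
  refine ⟨fun k => t * (D.logDeriv₁ k ^ 2 + D.logDeriv₂ k), fun k => by
    rw [← mul_assoc, ht, one_mul], fun k => ?_⟩
  have h : (2 : ℚ_[p]) * t = 1 := congrArg (fun z : ℤ_[p] => (z : ℚ_[p])) ht
  rw [PadicInt.coe_mul, ← two_mul_J₂_eq hx hG hH, ← mul_assoc, mul_comm (t : ℚ_[p]) 2, h, one_mul]

/-- The ranges are cut at a 0 and a 1. On each block the factors p y_j of P_k cancel the
denominators 1/r_j', leaving a common factor p; on the last block the two sums combine to the factor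
y 0 + y 1. -/
lemma Ctilde₁_eq (ha : D.a = fun j => negDigit p (r j)) (hx : ∀ j, (D.x j : ℚ_[p]) = r j)
    (hy : ∀ j, (D.y j : ℚ_[p]) = dash p (r j)) (hG : ∀ x : ℤ_[p], G₁ p x = D.G x)
    (hy0 : ∀ j, (D.y j : ℚ_[p]) ≠ 0) : Ctilde₁ p r = p * D.companion₁ := by
  have ha' : ∀ j, negDigit p (r j) = D.a j := fun j => by rw [ha]
  have hle := D.a_le₀
  have hle' := D.a_le₁
  simp only [Ctilde₁, ha', ← hy, J₁_eq hx hG]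
  rw [← sum_Icc_add_sum_Icc _ (Nat.zero_le _) D.a_le₀,
    ← sum_Icc_add_sum_Icc _ (by omega) D.a_le₁, companion₁]
  simp only [PadicInt.coe_add, PadicInt.coe_sum, mul_add, Finset.mul_sum]
  have e : ∀ a b c d e f g h : ℚ_[p], f = a → g = b + c → h = d + e →
      a + b + (c + d) + e = f + g + h := fun _ _ _ _ _ _ _ _ h1 h2 h3 => by
    rw [h1, h2, h3]; ring
  refine e _ _ _ _ _ _ _ _ ?_ ?_ ?_
  · refine Finset.sum_congr rfl fun k hk => ?_
    rw [Finset.mem_Icc] at hk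
    rw [pochQuot_eq hx (by omega), if_neg (by omega), if_neg (by omega)]
    push_cast
    ring
  · rw [← Finset.sum_add_distrib]
    refine Finset.sum_congr rfl fun k hk => ?_
    rw [Finset.mem_Icc] at hk
    rw [pochQuot_eq hx (by omega), if_pos (by omega), if_neg (by omega)]
    have := hy0 0
    push_cast
    field_simp
  · rw [← Finset.sum_add_distrib]
    refine Finset.sum_congr rfl fun k hk => ?_
    rw [Finset.mem_Icc] at hk
    rw [pochQuot_eq hx (by omega), if_pos (by omega), if_pos (by omega)]
    have := hy0 0
    have := hy0 1
    push_cast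
    field_simp
    ring

lemma Ctilde₂_eq (ha : D.a = fun j => negDigit p (r j)) (hx : ∀ j, (D.x j : ℚ_[p]) = r j)
    (hy : ∀ j, (D.y j : ℚ_[p]) = dash p (r j)) (hG : ∀ x : ℤ_[p], G₁ p x = D.G x)
    (hy0 : ∀ j, (D.y j : ℚ_[p]) ≠ 0) {J : ℕ → ℤ_[p]} (hJ : ∀ k, J₂ p r k = J k) :
    Ctilde₂ p r = p ^ 2 * D.companion₂ J := by
  have ha' : ∀ j, negDigit p (r j) = D.a j := fun j => by rw [ha]
  have hle := D.a_le₀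
  have hle' := D.a_le₁
  simp only [Ctilde₂, ha', ← hy, J₁_eq hx hG, hJ, companion₂]
  rw [PadicInt.coe_add, PadicInt.coe_add, PadicInt.coe_sum, PadicInt.coe_sum, PadicInt.coe_sum,
    mul_add ((p : ℚ_[p]) ^ 2), mul_add ((p : ℚ_[p]) ^ 2), Finset.mul_sum, Finset.mul_sum,
    Finset.mul_sum, Finset.mul_sum, Finset.mul_sum, Finset.mul_sum]
  refine congrArg₂ _ (congrArg₂ _ (Finset.sum_congr rfl fun k hk => ?_)
    (Finset.sum_congr rfl fun k hk => ?_)) (Finset.sum_congr rfl fun k hk => ?_) <;>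
    rw [Finset.mem_Icc] at hk
  · rw [pochQuot_eq hx (by omega), if_neg (by omega), if_neg (by omega)]
    push_cast
    ring
  · rw [pochQuot_eq hx (by omega), if_pos (by omega), if_neg (by omega)]
    have := hy0 0
    push_cast
    field_simp
  · rw [pochQuot_eq hx (by omega), if_pos (by omega), if_pos (by omega)]
    have := hy0 0
    have := hy0 1
    push_cast
    field_simp

end PairedData

end Companion

theorem mainTheorem4 (p : ℕ) [Fact p.Prime] (hp : 5 < p) (α : Multiset ℚ)
    (hα : Companion.IsCYMultiset α) (r : Fin 4 → ℚ)
    (hr : Companion.IsOrderedLabelling p α r) :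
    Companion.PadicCongr p 3 (Companion.Ctilde₁ p r)
      ((-1) ^ (Companion.negDigit p (r 0) + Companion.negDigit p (r 1)) * (p : ℚ_[p])) ∧
    Companion.PadicCongr p 3 (Companion.Ctilde₂ p r)
      (-(-1) ^ (Companion.negDigit p (r 0) + Companion.negDigit p (r 1)) * (p : ℚ_[p]) ^ 2) := by
  obtain ⟨D, ha, hx, hy, hG, hH, hy0⟩ := Companion.exists_pairedData hp hα hr
  obtain ⟨J, hJ, hJ₂⟩ := D.exists_J₂_eq hx hG hH
  have hs : ((-1) ^ (Companion.negDigit p (r 0) + Companion.negDigit p (r 1)) : ℚ_[p]) =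
      (D.sign : ℚ_[p]) := by
    rw [Companion.PairedData.sign, ha]
    push_cast
    rfl
  constructor
  · obtain ⟨z, hz⟩ := D.sq_dvd_companion₁_sub_sign hJ
    have h := congrArg (fun z : ℤ_[p] => (z : ℚ_[p])) hz
    push_cast at h
    refine ⟨z, ?_⟩
    rw [Companion.PairedData.Ctilde₁_eq ha hx hy hG hy0, hs]
    linear_combination (p : ℚ_[p]) * h
  · obtain ⟨z, hz⟩ := D.dvd_companion₂_add_sign hJ
    have h := congrArg (fun z : ℤ_[p] => (z : ℚ_[p])) hz
    push_cast at h
    refine ⟨z, ?_⟩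
    rw [Companion.PairedData.Ctilde₂_eq ha hx hy hG hy0 hJ₂, neg_mul, hs]
    linear_combination (p : ℚ_[p]) ^ 2 * h
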